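/- For $0<|q|<1$ put $$a(q)=-\sum_{n=-\infty}^{\infty}(-1)^n q^{(14n+5)^2/56},\qquad b(q)=\sum_{n=-\infty}^{\infty}(-1)^n q^{(14n+3)^2/56},\qquad c(q)=\sum_{n=-\infty}^{\infty}(-1)^n q^{(14n+1)^2/56},$$ $$(q^7;q^7)_\infty=\prod_{k=0}^{\infty}\bigl(1-q^{7}q^{7k}\bigr),\qquad E_2(q)=1-24\sum_{n=1}^{\infty}\Bigl(\sum_{d\mid n}d\Bigr)q^n,\qquad \mathcal P(q)=E_2(q^7),$$ $$x(q)=q^{7/8}(q^7;q^7)_\infty^3\,\frac{b(q)}{c^2(q)},\qquad y(q)=-q^{7/8}(q^7;q^7)_\infty^3\,\frac{a(q)}{b^2(q)},\qquad z(q)=q^{7/8}(q^7;q^7)_\infty^3\,\frac{c(q)}{a^2(q)},$$ where all fractional powers of $q$ are formed with the principal logarithm of $q$ (they cancel in $x,y,z$). Then, for every complex $q$ with $0<|q|<1$, the values $a(q),b(q),c(q)$ are nonzero, the functions $x,y,z,\mathcal P$ are complex differentiable at $q$, and \begin{align*} q\frac{d}{dq}x&=\frac{x}{12}\bigl(5y^2+5z^2-7x^2-20yz-52xy+7\mathcal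 P\bigr),\\ q\frac{d}{dq}y&=\frac{y}{12}\bigl(5z^2+5x^2-7y^2+20xz-52yz+7\mathcal P\bigr),\\ q\frac{d}{dq}z&=\frac{z}{12}\bigl(5x^2+5y^2-7z^2-20xy+52xz+7\mathcal P\bigr),\\ q\frac{d}{dq}\mathcal P&=\frac{7}{12}\bigl(\mathcal P^2-x^4+4x^3y+12xy^3-y^4-12x^3z+4y^3z-4xz^3+12yz^3-z^4\bigr). \end{align*} -/

import Mathlib

/-! Complex powers `q ^ s` below are `exp (s * log q)` with one and the same (principal) logarithm
in every term, so the fractional powers of `q` cancel in the quotients `septicX`, `septicY`,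
`septicZ`, which are single valued on the punctured unit disc. -/

/-- The infinite `q`-Pochhammer symbol `(a; q)_∞ = ∏_{k ≥ 0} (1 - a q ^ k)`. -/
noncomputable def qPochInf (a q : ℂ) : ℂ :=
  ∏' k : ℕ, (1 - a * q ^ k)

/-- The theta function `a(q) = - ∑_{n ∈ ℤ} (-1) ^ n q ^ ((14 n + 5) ^ 2 / 56)`. -/
noncomputable def septicA (q : ℂ) : ℂ :=
  -∑' n : ℤ, (-1 : ℂ) ^ n * q ^ ((14 * (n : ℂ) + 5) ^ 2 / 56)

/-- The theta function `b(q) = ∑_{n ∈ ℤ} (-1) ^ n q ^ ((14 n + 3) ^ 2 / 56)`. -/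
noncomputable def septicB (q : ℂ) : ℂ :=
  ∑' n : ℤ, (-1 : ℂ) ^ n * q ^ ((14 * (n : ℂ) + 3) ^ 2 / 56)

/-- The theta function `c(q) = ∑_{n ∈ ℤ} (-1) ^ n q ^ ((14 n + 1) ^ 2 / 56)`. -/
noncomputable def septicC (q : ℂ) : ℂ :=
  ∑' n : ℤ, (-1 : ℂ) ^ n * q ^ ((14 * (n : ℂ) + 1) ^ 2 / 56)

/-- `x(q) = q ^ (7/8) (q ^ 7; q ^ 7)_∞ ^ 3 b(q) / c(q) ^ 2`. -/
noncomputable def septicX (q : ℂ) : ℂ :=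
  q ^ (7 / 8 : ℂ) * qPochInf (q ^ 7) (q ^ 7) ^ 3 * (septicB q / septicC q ^ 2)

/-- `y(q) = - q ^ (7/8) (q ^ 7; q ^ 7)_∞ ^ 3 a(q) / b(q) ^ 2`. -/
noncomputable def septicY (q : ℂ) : ℂ :=
  -(q ^ (7 / 8 : ℂ) * qPochInf (q ^ 7) (q ^ 7) ^ 3 * (septicA q / septicB q ^ 2))

/-- `z(q) = q ^ (7/8) (q ^ 7; q ^ 7)_∞ ^ 3 c(q) / a(q) ^ 2`. -/
noncomputable def septicZ (q : ℂ) : ℂ :=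
  q ^ (7 / 8 : ℂ) * qPochInf (q ^ 7) (q ^ 7) ^ 3 * (septicC q / septicA q ^ 2)

/-- The Eisenstein series `E₂(q) = 1 - 24 ∑_{n ≥ 1} (∑_{d ∣ n} d) q ^ n`. -/
noncomputable def eisE2 (q : ℂ) : ℂ :=
  1 - 24 * ∑' n : ℕ, (∑ d ∈ (n + 1).divisors, (d : ℂ)) * q ^ (n + 1)

/-- `𝒫(q) = E₂(q ^ 7)`. -/
noncomputable def septicP (q : ℂ) : ℂ :=
  eisE2 (q ^ 7)

open Complex Filter Topology

/-! Write q = exp s and let θ(w) be the odd Jacobi theta series with parameter 7s. Completing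
squares turns a, b, c into exponential multiples of θ(s), θ(2s), θ(3s), the values of θ at 7-torsion
points. The prefactor of x, y, z is -θ'(0), by the triple product (`thetaSeries_zero_eq_product`,
`thetaSeries_one_zero`).

Let ζ = θ'/θ and e_r = ζ(rs) + r/7. Weierstrass' three term relation, differentiated at a
coincidence of two arguments, expresses ζ(A) + ζ(B) + ζ(C) - ζ(A+B+C) as a theta quotient
(`thetaSeries_logDeriv_addition`). At suitable torsion points this quotient is x, y or z, so these
are linear forms in e₁, e₂, e₃ (`septicX_exp`, `septicY_exp`, `septicZ_exp`).

Expanding the same formula to second order at C = 0 gives (ζ(A) + ζ(B) - ζ(A+B))² = E₂/4 - ζ'(A) -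
ζ'(B) - ζ'(A+B) (`thetaLog_square`), where E₂ enters through θ'''(0)/θ'(0). At torsion points this
determines the ζ'(rs) from the e_r and 𝒫, and forces one quadratic relation among the e_r.
Differentiating in A gives ζ'' and ζ''' as well.

The heat equation ∂θ/∂t = θ''/2 writes d/ds = q d/dq of e_r and of ζ'(rs) through these higher
logarithmic derivatives. Everything is then polynomial in e₁, e₂, e₃, 𝒫, and the four equations hold
modulo the quadratic relation (`septic_algebra`). -/

/-! ### The odd theta series: convergence, derivatives, parity, quasi-periodicity. -/

/-- The general term of `thetaSeries`. -/
noncomputable def thetaTerm (k : ℕ) (w t : ℂ) (n : ℤ) : ℂ :=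
  (-1) ^ n * ((n : ℂ) - 1 / 2) ^ k * exp (t * ((n : ℂ) - 1 / 2) ^ 2 / 2 + ((n : ℂ) - 1 / 2) * w)

/-- The `k`-th derivative in `w` of the odd Jacobi theta function
`∑ (-1) ^ n exp (t (n - 1/2) ^ 2 / 2 + (n - 1/2) w)`. -/
noncomputable def thetaSeries (k : ℕ) (w t : ℂ) : ℂ := ∑' n : ℤ, thetaTerm k w t n

theorem summable_exp_neg_abs_int : Summable fun n : ℤ ↦ Real.exp (-|(n : ℝ)|) := by
  have h : Summable fun n : ℕ ↦ Real.exp (-(n : ℝ)) := Real.summable_exp_neg_nat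
  apply Summable.of_nat_of_neg <;> simpa using h

/-- A Gaussian times a polynomial is dominated by a decaying exponential. -/
theorem pow_mul_exp_quadratic_le (k : ℕ) {δ R x : ℝ} (hδ : 0 < δ) (hx : 0 ≤ x) :
    x ^ k * Real.exp (-δ * x ^ 2 / 2 + R * x) ≤
      k.factorial * Real.exp ((R + 2) ^ 2 / (2 * δ)) * Real.exp (-x) := by
  have h1 : x ^ k ≤ k.factorial * Real.exp x := by
    have := Real.pow_div_factorial_le_exp x hx k
    rwa [div_le_iff₀ (by positivity), mul_comm] at this
  -- Completing the square. The 2 in R + 2 pays for the exp x that bounds the power and for the exp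
  -- (-x) kept as decay.
  have h2 : x - δ * x ^ 2 / 2 + R * x ≤ (R + 2) ^ 2 / (2 * δ) - x := by
    have : (R + 2) ^ 2 / (2 * δ) - x - (x - δ * x ^ 2 / 2 + R * x)
        = (R + 2 - δ * x) ^ 2 / (2 * δ) := by field_simp; ring
    have : 0 ≤ (R + 2 - δ * x) ^ 2 / (2 * δ) := by positivity
    linarith
  calc x ^ k * Real.exp (-δ * x ^ 2 / 2 + R * x)
      ≤ (k.factorial * Real.exp x) * Real.exp (-δ * x ^ 2 / 2 + R * x) := by gcongr
    _ = k.factorial * Real.exp (x - δ * x ^ 2 / 2 + R * x) := by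
        rw [mul_assoc, ← Real.exp_add]; ring_nf
    _ ≤ k.factorial * Real.exp ((R + 2) ^ 2 / (2 * δ) - x) := by gcongr
    _ = _ := by rw [mul_assoc, ← Real.exp_add]; ring_nf

/-- A summable bound for the theta terms that is uniform for `re t ≤ -δ` and `‖w‖ ≤ R`. -/
noncomputable def thetaBound (k : ℕ) (δ R : ℝ) (n : ℤ) : ℝ :=
  k.factorial * Real.exp ((R + 2) ^ 2 / (2 * δ)) * Real.exp 1 * Real.exp (-|(n : ℝ)|)

theorem summable_thetaBound (k : ℕ) (δ R : ℝ) : Summable (thetaBound k δ R) :=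
  summable_exp_neg_abs_int.mul_left _

theorem norm_thetaTerm_le (k : ℕ) {δ R : ℝ} (hδ : 0 < δ) {w t : ℂ} (ht : t.re ≤ -δ)
    (hw : ‖w‖ ≤ R) (n : ℤ) : ‖thetaTerm k w t n‖ ≤ thetaBound k δ R n := by
  set y : ℝ := (n : ℝ) - 1 / 2 with hy
  have hc : (n : ℂ) - 1 / 2 = (y : ℂ) := by simp [hy]
  have hre : (t * (y : ℂ) ^ 2 / 2 + (y : ℂ) * w).re = t.re * y ^ 2 / 2 + y * w.re := by
    have : t * (y : ℂ) ^ 2 / 2 + (y : ℂ) * w = ((y ^ 2 / 2 : ℝ) : ℂ) * t + (y : ℂ) * w := by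
      push_cast; ring
    rw [this, add_re, re_ofReal_mul, re_ofReal_mul]; ring
  have h1 : t.re * y ^ 2 / 2 + y * w.re ≤ -δ * |y| ^ 2 / 2 + R * |y| := by
    have h2 : y * w.re ≤ R * |y| := by
      calc y * w.re ≤ |y * w.re| := le_abs_self _
        _ = |w.re| * |y| := by rw [abs_mul, mul_comm]
        _ ≤ R * |y| := by gcongr; exact (abs_re_le_norm w).trans hw
    have h3 : t.re * y ^ 2 ≤ -δ * y ^ 2 := by gcongr
    rw [sq_abs]; linarith
  have h4 : -|y| ≤ 1 + -|(n : ℝ)| := by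
    have : |(n : ℝ)| ≤ |y| + |(1 / 2 : ℝ)| := by
      have := abs_add_le y (1 / 2); simpa [hy] using this
    rw [abs_of_pos (by norm_num : (0 : ℝ) < 1 / 2)] at this
    linarith
  unfold thetaTerm thetaBound
  rw [hc, norm_mul, norm_mul, norm_pow, norm_zpow, norm_neg, norm_one, one_zpow, one_mul,
    norm_exp, hre, norm_real, Real.norm_eq_abs]
  calc |y| ^ k * Real.exp (t.re * y ^ 2 / 2 + y * w.re)
      ≤ |y| ^ k * Real.exp (-δ * |y| ^ 2 / 2 + R * |y|) := by gcongr
    _ ≤ k.factorial * Real.exp ((R + 2) ^ 2 / (2 * δ)) * Real.exp (-|y|) :=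
        pow_mul_exp_quadratic_le k hδ (abs_nonneg y)
    _ ≤ k.factorial * Real.exp ((R + 2) ^ 2 / (2 * δ)) * Real.exp (1 + -|(n : ℝ)|) := by gcongr
    _ = _ := by rw [Real.exp_add, mul_assoc, mul_assoc, mul_assoc]

theorem summable_norm_thetaTerm (k : ℕ) (w : ℂ) {t : ℂ} (ht : t.re < 0) :
    Summable fun n ↦ ‖thetaTerm k w t n‖ :=
  (summable_thetaBound k (-t.re) ‖w‖).of_nonneg_of_le (fun _ ↦ norm_nonneg _)
    (norm_thetaTerm_le k (neg_pos.2 ht) (by simp) le_rfl)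

theorem summable_thetaTerm (k : ℕ) (w : ℂ) {t : ℂ} (ht : t.re < 0) :
    Summable (thetaTerm k w t) := (summable_norm_thetaTerm k w ht).of_norm

theorem hasDerivAt_thetaTerm (k : ℕ) (a b c d s : ℂ) (n : ℤ) :
    HasDerivAt (fun s ↦ thetaTerm k (a * s + b) (c * s + d) n)
      (a * thetaTerm (k + 1) (a * s + b) (c * s + d) n
        + c / 2 * thetaTerm (k + 2) (a * s + b) (c * s + d) n) s := by
  unfold thetaTerm
  have h1 : HasDerivAt (fun s : ℂ ↦ a * s + b) a s := by
    simpa using ((hasDerivAt_id s).const_mul a).add_const b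
  have h2 : HasDerivAt (fun s : ℂ ↦ c * s + d) c s := by
    simpa using ((hasDerivAt_id s).const_mul c).add_const d
  refine ((((h2.mul_const (((n : ℂ) - 1 / 2) ^ 2)).div_const 2).add
    (h1.const_mul ((n : ℂ) - 1 / 2))).cexp.const_mul ((-1) ^ n * ((n : ℂ) - 1 / 2) ^ k)).congr_deriv ?_
  simp only [Pi.add_apply]
  ring

/-- The theta series along an affine curve; the case `a = 0` is the heat equation. -/
theorem hasDerivAt_thetaSeries (k : ℕ) (a b c d : ℂ) {s : ℂ} (hs : (c * s + d).re < 0) :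
    HasDerivAt (fun s ↦ thetaSeries k (a * s + b) (c * s + d))
      (a * thetaSeries (k + 1) (a * s + b) (c * s + d)
        + c / 2 * thetaSeries (k + 2) (a * s + b) (c * s + d)) s := by
  set δ : ℝ := -(c * s + d).re / 2 with hδ
  set R : ℝ := ‖a * s + b‖ + ‖a‖ with hR
  have hδ0 : 0 < δ := by rw [hδ]; linarith
  -- On a ball of this radius the parameter stays in re ≤ -δ and the argument in norm ≤ R, so one
  -- summable majorant serves all points. The +1 covers c = 0.
  set r : ℝ := min 1 (δ / (‖c‖ + 1)) with hr
  have hr0 : 0 < r := lt_min one_pos (by positivity)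
  have key : ∀ y ∈ Metric.ball s r, (c * y + d).re ≤ -δ ∧ ‖a * y + b‖ ≤ R := by
    intro y hy
    rw [Metric.mem_ball, dist_eq_norm] at hy
    have hy1 : ‖y - s‖ ≤ 1 := hy.le.trans (min_le_left _ _)
    have hy2 : ‖y - s‖ ≤ δ / (‖c‖ + 1) := hy.le.trans (min_le_right _ _)
    constructor
    · have e : c * y + d = (c * s + d) + c * (y - s) := by ring
      have : (c * (y - s)).re ≤ δ := by
        calc (c * (y - s)).re ≤ ‖c * (y - s)‖ := re_le_norm _
          _ = ‖c‖ * ‖y - s‖ := norm_mul _ _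
          _ ≤ (‖c‖ + 1) * (δ / (‖c‖ + 1)) := by gcongr; linarith
          _ = δ := by field_simp
      rw [e, add_re]; linarith
    · have e : a * y + b = (a * s + b) + a * (y - s) := by ring
      rw [e]
      refine (norm_add_le _ _).trans ?_
      rw [norm_mul, hR]
      gcongr
      exact mul_le_of_le_one_right (norm_nonneg _) hy1
  have hs0 : s ∈ Metric.ball s r := Metric.mem_ball_self hr0
  have H := hasDerivAt_tsum_of_isPreconnected
    (u := fun n ↦ ‖a‖ * thetaBound (k + 1) δ R n + ‖c / 2‖ * thetaBound (k + 2) δ R n)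
    (g := fun n s ↦ thetaTerm k (a * s + b) (c * s + d) n)
    (g' := fun n s ↦ a * thetaTerm (k + 1) (a * s + b) (c * s + d) n
        + c / 2 * thetaTerm (k + 2) (a * s + b) (c * s + d) n)
    (((summable_thetaBound _ _ _).mul_left _).add ((summable_thetaBound _ _ _).mul_left _))
    Metric.isOpen_ball (convex_ball s r).isPreconnected
    (fun n y _ ↦ hasDerivAt_thetaTerm k a b c d y n)
    (fun n y hy ↦ by
      obtain ⟨h1, h2⟩ := key y hy
      refine (norm_add_le _ _).trans ?_
      rw [norm_mul, norm_mul]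
      gcongr
      · exact norm_thetaTerm_le _ hδ0 h1 h2 n
      · exact norm_thetaTerm_le _ hδ0 h1 h2 n)
    hs0 (summable_thetaTerm k _ hs) hs0
  have e := (((summable_thetaTerm (k + 1) (a * s + b) hs).hasSum.mul_left a).add
    ((summable_thetaTerm (k + 2) (a * s + b) hs).hasSum.mul_left (c / 2))).tsum_eq
  rw [e] at H
  exact H

theorem hasDerivAt_thetaSeries_left (k : ℕ) {t : ℂ} (ht : t.re < 0) (w : ℂ) :
    HasDerivAt (fun w ↦ thetaSeries k w t) (thetaSeries (k + 1) w t) w := by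
  simpa using hasDerivAt_thetaSeries k 1 0 0 t (s := w) (by simpa using ht)

/-- The reflection n ↦ 1 - n negates n - 1/2 and flips the sign (-1)^n. -/
theorem thetaSeries_neg (k : ℕ) (w t : ℂ) :
    thetaSeries k (-w) t = (-1) ^ (k + 1) * thetaSeries k w t := by
  unfold thetaSeries
  rw [← (Equiv.subLeft (1 : ℤ)).tsum_eq, ← tsum_mul_left]
  refine tsum_congr fun n ↦ ?_
  simp only [thetaTerm, Equiv.subLeft_apply]
  have h : (((1 - n : ℤ) : ℂ) - 1 / 2) = -((n : ℂ) - 1 / 2) := by push_cast; ring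
  have h' : ((-1 : ℂ)) ^ (1 - n) = -(-1) ^ n := by
    rw [zpow_sub₀ (by norm_num), zpow_one, div_eq_mul_inv, ← inv_zpow]; norm_num
  rw [h, h', neg_pow ((n : ℂ) - 1 / 2) k, pow_succ (-1 : ℂ) k, neg_sq, neg_mul_neg]
  ring

theorem thetaTerm_add_period (k : ℕ) (w t : ℂ) (n : ℤ) :
    thetaTerm k (w + t) t (n - 1) = -exp (-t / 2 - w) *
      ((-1) ^ n * ((n : ℂ) - 1 / 2 - 1) ^ k *
        exp (t * ((n : ℂ) - 1 / 2) ^ 2 / 2 + ((n : ℂ) - 1 / 2) * w)) := by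
  have h' : ((-1 : ℂ)) ^ (n - 1) = -(-1) ^ n := by
    rw [zpow_sub_one₀ (by norm_num)]; norm_num
  have e : t * (((n - 1 : ℤ) : ℂ) - 1 / 2) ^ 2 / 2 + (((n - 1 : ℤ) : ℂ) - 1 / 2) * (w + t) =
      (-t / 2 - w) + (t * ((n : ℂ) - 1 / 2) ^ 2 / 2 + ((n : ℂ) - 1 / 2) * w) := by
    push_cast; ring
  unfold thetaTerm
  rw [e, exp_add, h']
  push_cast
  ring

theorem thetaSeries_zero_add_period (w t : ℂ) :
    thetaSeries 0 (w + t) t = -exp (-t / 2 - w) * thetaSeries 0 w t := by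
  unfold thetaSeries
  rw [← (Equiv.subRight (1 : ℤ)).tsum_eq, ← tsum_mul_left]
  refine tsum_congr fun n ↦ ?_
  rw [Equiv.subRight_apply, thetaTerm_add_period]
  simp [thetaTerm]

theorem thetaSeries_one_add_period (w : ℂ) {t : ℂ} (ht : t.re < 0) :
    thetaSeries 1 (w + t) t =
      -exp (-t / 2 - w) * (thetaSeries 1 w t - thetaSeries 0 w t) := by
  unfold thetaSeries
  rw [← (summable_thetaTerm 1 w ht).tsum_sub (summable_thetaTerm 0 w ht),
    ← (Equiv.subRight (1 : ℤ)).tsum_eq, ← tsum_mul_left]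
  refine tsum_congr fun n ↦ ?_
  rw [Equiv.subRight_apply, thetaTerm_add_period]
  simp only [thetaTerm]
  ring

/-! ### Addition formulas of Weierstrass type. -/

/-- The odd component in the splitting of `θ (a + b) θ (a - b)`. -/
noncomputable def thetaOdd (a t : ℂ) : ℂ :=
  ∑' m : ℤ, exp (t * (2 * m + 1) ^ 2 / 4 + (2 * m + 1) * a)

/-- The even component in the splitting of `θ (a + b) θ (a - b)`. -/
noncomputable def thetaEven (a t : ℂ) : ℂ :=
  ∑' m : ℤ, exp (t * (2 * m) ^ 2 / 4 + 2 * m * a)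

/-- Up to a constant factor and a sign this is a theta term with parameter 2t, and the norm ignores
the sign. -/
theorem summable_norm_exp_quadratic {t : ℂ} (ht : t.re < 0) (α β : ℂ) :
    Summable fun m : ℤ ↦ ‖exp (t * m ^ 2 + α * m + β)‖ := by
  have h := (summable_norm_thetaTerm 0 (2 * t / 2 + α) (t := 2 * t)
    (by have : (2 * t).re = 2 * t.re := by simp
        linarith)).mul_left
    ‖exp (t / 4 + α / 2 + β)‖
  refine h.congr fun m ↦ ?_
  rw [← norm_mul, thetaTerm, norm_mul, norm_mul, norm_mul, norm_zpow, norm_neg, norm_one, one_zpow,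
    pow_zero, norm_one, one_mul, one_mul, ← norm_mul, ← exp_add]
  congr 2
  ring

theorem summable_norm_thetaOdd (a : ℂ) {t : ℂ} (ht : t.re < 0) :
    Summable fun m : ℤ ↦ ‖exp (t * (2 * m + 1) ^ 2 / 4 + (2 * m + 1) * a)‖ :=
  (summable_norm_exp_quadratic ht (t + 2 * a) (t / 4 + a)).congr fun m ↦ by congr 2; ring

theorem summable_norm_thetaEven (a : ℂ) {t : ℂ} (ht : t.re < 0) :
    Summable fun m : ℤ ↦ ‖exp (t * (2 * m) ^ 2 / 4 + 2 * m * a)‖ :=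
  (summable_norm_exp_quadratic ht (2 * a) 0).congr fun m ↦ by congr 2; ring

/-- Pairs of integers split according to the parity of their sum. -/
noncomputable def intPairParity : (ℤ × ℤ) ⊕ (ℤ × ℤ) ≃ ℤ × ℤ :=
  Equiv.ofBijective
    (Sum.elim (fun p ↦ (p.1 + p.2 + 1, p.1 - p.2 + 1)) (fun p ↦ (p.1 + p.2 + 1, p.1 - p.2))) <| by
    constructor
    · rintro (⟨i, j⟩ | ⟨i, j⟩) (⟨k, l⟩ | ⟨k, l⟩) h <;>
        simp only [Sum.elim_inl, Sum.elim_inr, Prod.mk.injEq, Sum.inl.injEq, Sum.inr.injEq,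
          reduceCtorEq] at h ⊢ <;> omega
    · rintro ⟨m, n⟩
      rcases Int.even_or_odd' (m + n) with ⟨c, hc | hc⟩
      · refine ⟨.inl (c - 1, m - c), ?_⟩
        simp only [Sum.elim_inl, Prod.mk.injEq]; omega
      · refine ⟨.inr (c, m - c - 1), ?_⟩
        simp only [Sum.elim_inr, Prod.mk.injEq]; omega

/-- For half-integers u, v the exponent t(u² + v²)/2 + u(a+b) + v(a-b) separates in u + v and u - v,
which are integers of opposite parity. The result is a 2×2 determinant in a and b, so the three term
relation becomes the Plücker relation. -/
theorem thetaSeries_add_mul_sub (a b : ℂ) {t : ℂ} (ht : t.re < 0) :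
    thetaSeries 0 (a + b) t * thetaSeries 0 (a - b) t =
      thetaOdd a t * thetaEven b t - thetaEven a t * thetaOdd b t := by
  have h1 := summable_norm_thetaTerm 0 (a + b) ht
  have h2 := summable_norm_thetaTerm 0 (a - b) ht
  have oa := summable_norm_thetaOdd a ht
  have ob := summable_norm_thetaOdd b ht
  have ea := summable_norm_thetaEven a ht
  have eb := summable_norm_thetaEven b ht
  unfold thetaSeries thetaOdd thetaEven
  rw [tsum_mul_tsum_of_summable_norm h1 h2, tsum_mul_tsum_of_summable_norm oa eb,
    tsum_mul_tsum_of_summable_norm ea ob, ← intPairParity.tsum_eq]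
  have s1 := (summable_mul_of_summable_norm oa eb)
  have s2 := (summable_mul_of_summable_norm ea ob)
  have sgn : ∀ i j : ℤ, (-1 : ℂ) ^ (i + j + 1) * (-1) ^ (i - j) = -1 := fun i j ↦ by
    rw [← zpow_add₀ (by norm_num), show i + j + 1 + (i - j) = 2 * i + 1 by ring,
      zpow_add₀ (by norm_num), zpow_mul]
    simp
  have t1 : ∀ p : ℤ × ℤ, thetaTerm 0 (a + b) t (p.1 + p.2 + 1) *
      thetaTerm 0 (a - b) t (p.1 - p.2 + 1) =
      exp (t * (2 * p.1 + 1) ^ 2 / 4 + (2 * p.1 + 1) * a) *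
        exp (t * (2 * p.2) ^ 2 / 4 + 2 * p.2 * b) := by
    rintro ⟨i, j⟩
    have e : ((-1 : ℂ) ^ (i + j + 1) * (-1) ^ (i - j + 1)) = 1 := by
      rw [zpow_add_one₀ (by norm_num) (i - j), ← mul_assoc, sgn]; norm_num
    simp only [thetaTerm, pow_zero, mul_one]
    rw [mul_mul_mul_comm, e, one_mul, ← exp_add, ← exp_add]
    congr 1
    push_cast
    ring
  have t2 : ∀ p : ℤ × ℤ, thetaTerm 0 (a + b) t (p.1 + p.2 + 1) *
      thetaTerm 0 (a - b) t (p.1 - p.2) =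
      -(exp (t * (2 * p.1) ^ 2 / 4 + 2 * p.1 * a) *
        exp (t * (2 * p.2 + 1) ^ 2 / 4 + (2 * p.2 + 1) * b)) := by
    rintro ⟨i, j⟩
    simp only [thetaTerm, pow_zero, mul_one]
    rw [mul_mul_mul_comm, sgn, neg_one_mul, ← exp_add, ← exp_add]
    congr 2
    push_cast
    ring
  have H := HasSum.sum (f := fun p ↦ thetaTerm 0 (a + b) t (intPairParity p).1 *
      thetaTerm 0 (a - b) t (intPairParity p).2)
    (s1.hasSum.congr_fun fun p ↦ t1 p) (s2.hasSum.neg.congr_fun fun p ↦ t2 p)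
  rw [H.tsum_eq, sub_eq_add_neg]

/-- Weierstrass' three term relation. -/
theorem thetaSeries_three_term (a b c d : ℂ) {t : ℂ} (ht : t.re < 0) :
    thetaSeries 0 (a + b) t * thetaSeries 0 (a - b) t *
        (thetaSeries 0 (c + d) t * thetaSeries 0 (c - d) t) +
      thetaSeries 0 (b + c) t * thetaSeries 0 (b - c) t *
        (thetaSeries 0 (a + d) t * thetaSeries 0 (a - d) t) +
      thetaSeries 0 (c + a) t * thetaSeries 0 (c - a) t *
        (thetaSeries 0 (b + d) t * thetaSeries 0 (b - d) t) = 0 := by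
  simp only [thetaSeries_add_mul_sub _ _ ht]
  ring

theorem thetaSeries_zero_zero (t : ℂ) : thetaSeries 0 0 t = 0 := by
  have := thetaSeries_neg 0 0 t
  simp only [neg_zero, zero_add, pow_one, neg_one_mul] at this
  exact self_eq_neg.1 this

theorem thetaSeries_two_zero (t : ℂ) : thetaSeries 2 0 t = 0 := by
  have := thetaSeries_neg 2 0 t
  norm_num at this
  exact self_eq_neg.1 this

theorem hasDerivAt_thetaSeries_comp (k : ℕ) {t : ℂ} (ht : t.re < 0) {f : ℂ → ℂ} {f' z : ℂ}
    (hf : HasDerivAt f f' z) :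
    HasDerivAt (fun z ↦ thetaSeries k (f z) t) (thetaSeries (k + 1) (f z) t * f') z :=
  (hasDerivAt_thetaSeries_left k ht (f z)).comp z hf

/-- The addition formula for `θ' / θ`, cleared of denominators. -/
theorem thetaSeries_logDeriv_addition (A B C : ℂ) {t : ℂ} (ht : t.re < 0) :
    thetaSeries 1 0 t * (thetaSeries 0 (A + B) t * thetaSeries 0 (B + C) t *
        thetaSeries 0 (A + C) t) =
      (thetaSeries 1 A t * thetaSeries 0 B t + thetaSeries 0 A t * thetaSeries 1 B t) *
          (thetaSeries 0 C t * thetaSeries 0 (A + B + C) t) +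
        thetaSeries 0 A t * thetaSeries 0 B t *
          (thetaSeries 1 C t * thetaSeries 0 (A + B + C) t -
            thetaSeries 0 C t * thetaSeries 1 (A + B + C) t) := by
  -- Chosen so that A + B = 2c, A + C = a + b, B + C = b - a and A + B + C = b + c. The relation is
  -- then differentiated in d at d = c, where θ(c - d) vanishes and contributes -θ'(0).
  obtain ⟨a, b, c, rfl, rfl, rfl⟩ : ∃ a b c : ℂ, A = a + c ∧ B = c - a ∧ C = b - c :=
    ⟨(A - B) / 2, C + (A + B) / 2, (A + B) / 2, by ring, by ring, by ring⟩
  have p : ∀ x : ℂ, HasDerivAt (fun d ↦ x + d) 1 c := fun x ↦ (hasDerivAt_id c).const_add x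
  have m : ∀ x : ℂ, HasDerivAt (fun d ↦ x - d) (-1) c := fun x ↦ (hasDerivAt_id c).const_sub x
  have P := fun x ↦ hasDerivAt_thetaSeries_comp 0 ht (p x)
  have M := fun x ↦ hasDerivAt_thetaSeries_comp 0 ht (m x)
  have H := (((((P c).mul (M c)).const_mul (thetaSeries 0 (a + b) t * thetaSeries 0 (a - b) t)).add
    (((P a).mul (M a)).const_mul (thetaSeries 0 (b + c) t * thetaSeries 0 (b - c) t))).add
    (((P b).mul (M b)).const_mul (thetaSeries 0 (c + a) t * thetaSeries 0 (c - a) t)))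
  have H0 := H.unique ((hasDerivAt_const c (0 : ℂ)).congr_of_eventuallyEq
    (.of_forall fun d ↦ thetaSeries_three_term a b c d ht))
  have e1 : a + c + (c - a) = c + c := by ring
  have e2 : c - a + (b - c) = -(a - b) := by ring
  have e3 : a + c + (b - c) = a + b := by ring
  have e4 : c + c + (b - c) = b + c := by ring
  have n1 : c - a = -(a - c) := by ring
  rw [e1, e2, e3, e4, n1, thetaSeries_neg 0 (a - b), thetaSeries_neg 0 (a - c),
    thetaSeries_neg 1 (a - c)]
  rw [add_comm c a, n1, thetaSeries_neg 0 (a - c)] at H0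
  simp only [sub_self, thetaSeries_zero_zero, zero_add] at H0
  linear_combination H0

/-- The square of `ζ (A) + ζ (B) - ζ (A + B)` in terms of `℘`, in polynomial form. -/
theorem thetaSeries_square_addition (A B : ℂ) {t : ℂ} (ht : t.re < 0)
    (hK : thetaSeries 1 0 t ≠ 0) :
    thetaSeries 0 (A + B) t * (thetaSeries 2 B t * thetaSeries 0 A t +
        2 * (thetaSeries 1 B t * thetaSeries 1 A t) + thetaSeries 0 B t * thetaSeries 2 A t) -
      2 * (thetaSeries 1 A t * thetaSeries 0 B t + thetaSeries 0 A t * thetaSeries 1 B t) *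
        thetaSeries 1 (A + B) t +
      thetaSeries 0 A t * thetaSeries 0 B t *
        (thetaSeries 2 (A + B) t
          - thetaSeries 3 0 t / thetaSeries 1 0 t * thetaSeries 0 (A + B) t) = 0 := by
  have p : ∀ x C : ℂ, HasDerivAt (fun C ↦ x + C) 1 C := fun x C ↦ (hasDerivAt_id C).const_add x
  have P := fun k x C ↦ hasDerivAt_thetaSeries_comp k ht (p x C)
  have Z := fun k C ↦ hasDerivAt_thetaSeries_left k ht C
  have D1 := fun C ↦ (((P 0 B C).mul (P 0 A C)).const_mul
      (thetaSeries 1 0 t * thetaSeries 0 (A + B) t)).sub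
    ((((Z 0 C).mul (P 0 (A + B) C)).const_mul
      (thetaSeries 1 A t * thetaSeries 0 B t + thetaSeries 0 A t * thetaSeries 1 B t)).add
    ((((Z 1 C).mul (P 0 (A + B) C)).sub ((Z 0 C).mul (P 1 (A + B) C))).const_mul
      (thetaSeries 0 A t * thetaSeries 0 B t)))
  have E1 := fun C ↦ (D1 C).unique ((hasDerivAt_const C (0 : ℂ)).congr_of_eventuallyEq
    (.of_forall fun C ↦ by
      have := thetaSeries_logDeriv_addition A B C ht
      simp only [Pi.sub_apply, Pi.mul_apply, Pi.add_apply]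
      linear_combination this))
  -- Orders 0 and 1 in C are trivial at C = 0. The second derivative is the first to carry
  -- information, and there θ(0) = θ''(0) = 0 leaves only θ'(0) and θ'''(0).
  have D2 := ((((P 1 B 0).mul (P 0 A 0)).add ((P 0 B 0).mul (P 1 A 0))).const_mul
      (thetaSeries 1 0 t * thetaSeries 0 (A + B) t)).sub
    (((((Z 1 0).mul (P 0 (A + B) 0)).add ((Z 0 0).mul (P 1 (A + B) 0))).const_mul
      (thetaSeries 1 A t * thetaSeries 0 B t + thetaSeries 0 A t * thetaSeries 1 B t)).add
    ((((Z 2 0).mul (P 0 (A + B) 0)).sub ((Z 0 0).mul (P 2 (A + B) 0))).const_mul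
      (thetaSeries 0 A t * thetaSeries 0 B t)))
  have E2 := D2.unique ((hasDerivAt_const (0 : ℂ) (0 : ℂ)).congr_of_eventuallyEq
    (.of_forall fun C ↦ by
      have := E1 C
      simp only [Pi.sub_apply, Pi.mul_apply, Pi.add_apply]
      linear_combination this))
  simp only [zero_add, add_zero, mul_one, thetaSeries_zero_zero, thetaSeries_two_zero,
    Nat.reduceAdd, zero_mul] at E2
  field_simp
  linear_combination E2

/-! ### Infinite q-products and the Jacobi triple product. -/

theorem norm_exp_lt_one {t : ℂ} (ht : t.re < 0) : ‖exp t‖ < 1 := by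
  rw [norm_exp]; exact Real.exp_lt_one_iff.2 ht

theorem summable_norm_mul_pow (a : ℂ) {q : ℂ} (hq : ‖q‖ < 1) :
    Summable fun k : ℕ ↦ ‖-(a * q ^ k)‖ := by
  simpa using (summable_geometric_of_lt_one (norm_nonneg q) hq).mul_left ‖a‖

theorem multipliable_qPochInf (a : ℂ) {q : ℂ} (hq : ‖q‖ < 1) :
    Multipliable fun k : ℕ ↦ 1 - a * q ^ k := by
  simpa [sub_eq_add_neg] using multipliable_one_add_of_summable (summable_norm_mul_pow a hq)

theorem tendsto_qPochInf (a : ℂ) {q : ℂ} (hq : ‖q‖ < 1) :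
    Tendsto (fun N ↦ ∏ k ∈ Finset.range N, (1 - a * q ^ k)) atTop (𝓝 (qPochInf a q)) :=
  (multipliable_qPochInf a hq).hasProd.tendsto_prod_nat

theorem qPochInf_ne_zero {a q : ℂ} (hq : ‖q‖ < 1) (h : ∀ k : ℕ, a * q ^ k ≠ 1) :
    qPochInf a q ≠ 0 := by
  have := tprod_one_add_ne_zero_of_summable (f := fun k : ℕ ↦ -(a * q ^ k))
    (fun k ↦ by rw [← sub_eq_add_neg, sub_ne_zero]; exact (h k).symm) (summable_norm_mul_pow a hq)
  simpa [qPochInf, sub_eq_add_neg] using this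

theorem qPochInf_ne_zero_of_norm_lt {a q : ℂ} (hq : ‖q‖ < 1) (ha : ‖a‖ < 1) :
    qPochInf a q ≠ 0 := by
  refine qPochInf_ne_zero hq fun k h ↦ ?_
  have h1 : ‖a * q ^ k‖ < 1 := by
    rw [norm_mul, norm_pow]
    exact (mul_le_of_le_one_right (norm_nonneg _) (pow_le_one₀ (norm_nonneg _) hq.le)).trans_lt ha
  rw [h, norm_one] at h1
  exact lt_irrefl _ h1

theorem qPochInf_eq_mul (a : ℂ) {q : ℂ} (hq : ‖q‖ < 1) :
    qPochInf a q = (1 - a) * qPochInf (a * q) q := by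
  have h := multipliable_qPochInf (a * q) hq
  unfold qPochInf
  rw [tprod_eq_zero_mul' (h.congr fun k ↦ by ring)]
  simp only [pow_zero, mul_one]
  congr 2
  ext k
  ring

theorem differentiable_qPochInf {q : ℂ} (hq : ‖q‖ < 1) :
    Differentiable ℂ fun a ↦ qPochInf a q := by
  intro a
  have hs : Summable fun k : ℕ ↦ (‖a‖ + 1) * ‖q‖ ^ k :=
    (summable_geometric_of_lt_one (norm_nonneg q) hq).mul_left _
  have H := hs.hasProdLocallyUniformlyOn_nat_one_add (f := fun k a ↦ -(a * q ^ k))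
    (Metric.isOpen_ball (x := a) (ε := 1)) (.of_forall fun n x hx ↦ by
      rw [norm_neg, norm_mul, norm_pow]
      gcongr
      rw [Metric.mem_ball, dist_eq_norm] at hx
      calc ‖x‖ = ‖a + (x - a)‖ := by ring_nf
        _ ≤ ‖a‖ + ‖x - a‖ := norm_add_le _ _
        _ ≤ ‖a‖ + 1 := by gcongr) (fun n ↦ by fun_prop)
  have D := H.differentiableOn (.of_forall fun _ ↦ by
    simpa [Finset.prod_fn] using DifferentiableOn.finsetProd (fun _ _ ↦ by fun_prop))
    Metric.isOpen_ball
  have := D.differentiableAt (Metric.isOpen_ball.mem_nhds (Metric.mem_ball_self one_pos))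
  simpa [qPochInf, sub_eq_add_neg] using! this

/-- The finite product `(q; q)_m`. -/
noncomputable def qFact (q : ℂ) (m : ℕ) : ℂ := ∏ k ∈ Finset.range m, (1 - q * q ^ k)

theorem one_sub_pow_ne_zero {q : ℂ} (hq : ‖q‖ < 1) (k : ℕ) : 1 - q * q ^ k ≠ 0 := by
  rw [← pow_succ', sub_ne_zero]
  intro h
  have h1 : ‖q ^ (k + 1)‖ < 1 := by
    rw [norm_pow]; exact pow_lt_one₀ (norm_nonneg _) hq (Nat.succ_ne_zero k)
  rw [← h, norm_one] at h1
  exact lt_irrefl _ h1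

theorem qFact_ne_zero {q : ℂ} (hq : ‖q‖ < 1) (m : ℕ) : qFact q m ≠ 0 :=
  Finset.prod_ne_zero_iff.2 fun k _ ↦ one_sub_pow_ne_zero hq k

theorem qFact_succ (q : ℂ) (m : ℕ) : qFact q (m + 1) = qFact q m * (1 - q ^ (m + 1)) := by
  rw [qFact, Finset.prod_range_succ, ← qFact, pow_succ' q m]

/-- `1 / (q; q)_m` for an integer `m`, which is zero for negative `m`. -/
noncomputable def qFactInv (q : ℂ) (m : ℤ) : ℂ := if 0 ≤ m then (qFact q m.toNat)⁻¹ else 0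

/-- With the value zero at negative integers the recurrence holds for every m, since 1 - q^0 = 0.
This removes boundary cases from the q-Pascal rule. -/
theorem qFactInv_sub_one {q : ℂ} (hq : ‖q‖ < 1) (m : ℤ) :
    qFactInv q (m - 1) = (1 - q ^ m) * qFactInv q m := by
  rcases lt_trichotomy m 0 with h | rfl | h
  · rw [qFactInv, qFactInv, if_neg (by omega), if_neg (by omega), mul_zero]
  · simp [qFactInv]
  · obtain ⟨k, rfl⟩ : ∃ k : ℕ, m = k + 1 := ⟨(m - 1).toNat, by omega⟩
    have h1 : ((k : ℤ) + 1).toNat = k + 1 := by omega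
    have h2 : (1 - q ^ (k + 1)) ≠ 0 := by
      have := one_sub_pow_ne_zero hq k
      rwa [← pow_succ'] at this
    have h3 := qFact_ne_zero hq k
    have h4 : q ^ ((k : ℤ) + 1) = q ^ (k + 1) := by exact_mod_cast zpow_natCast q (k + 1)
    rw [qFactInv, qFactInv, if_pos (by omega), if_pos (by omega), h1, qFact_succ, h4]
    simp only [add_sub_cancel_right, Int.toNat_natCast]
    field_simp

/-- The Gaussian binomial coefficient `[2N; N+n]`. -/
noncomputable def centralQBinom (q : ℂ) (N : ℕ) (n : ℤ) : ℂ :=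
  qFact q (2 * N) * qFactInv q (N + n) * qFactInv q (N - n)

/-- The two-step q-Pascal rule: it is the coefficient form of multiplying the finite product by its
two new factors. -/
theorem centralQBinom_succ {q : ℂ} (hq : ‖q‖ < 1) (hq0 : q ≠ 0) (N : ℕ) (n : ℤ) :
    centralQBinom q (N + 1) n = (1 + q ^ (2 * N + 1)) * centralQBinom q N n +
      q ^ ((N : ℤ) + 1 - n) * centralQBinom q N (n - 1) +
      q ^ ((N : ℤ) + 1 + n) * centralQBinom q N (n + 1) := by
  have g1 := qFactInv_sub_one hq (N + 1 + n)
  have g2 := qFactInv_sub_one hq (N + 1 - n)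
  have g3 := qFactInv_sub_one hq (N + n)
  have g4 := qFactInv_sub_one hq (N - n)
  have z1 : q ^ ((N : ℤ) + n) = q ^ ((N : ℤ) + 1 + n) / q := by
    rw [div_eq_mul_inv, ← zpow_sub_one₀ hq0]; ring_nf
  have z2 : q ^ ((N : ℤ) - n) = q ^ ((N : ℤ) + 1 - n) / q := by
    rw [div_eq_mul_inv, ← zpow_sub_one₀ hq0]; ring_nf
  have z3 : q ^ (2 * N + 1) = q ^ ((N : ℤ) + 1 + n) * q ^ ((N : ℤ) + 1 - n) / q := by
    rw [← zpow_add₀ hq0, div_eq_mul_inv, ← zpow_sub_one₀ hq0, ← zpow_natCast]; push_cast; ring_nf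
  have f1 : qFact q (2 * (N + 1)) =
      qFact q (2 * N) * (1 - q ^ (2 * N + 1)) * (1 - q ^ (2 * N + 1) * q) := by
    rw [show 2 * (N + 1) = 2 * N + 1 + 1 by ring, qFact_succ, qFact_succ, pow_succ q (2 * N + 1)]
  rw [show (N : ℤ) + 1 + n - 1 = N + n by ring] at g1
  rw [show (N : ℤ) + 1 - n - 1 = N - n by ring] at g2
  unfold centralQBinom
  rw [f1, show (N : ℤ) + (n - 1) = N + n - 1 by ring, show (N : ℤ) - (n - 1) = N + 1 - n by ring,
    show (N : ℤ) + (n + 1) = N + 1 + n by ring, show (N : ℤ) - (n + 1) = N - n - 1 by ring,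
    g3, g4, g1, g2, z1, z2, z3]
  push_cast
  field_simp
  ring

/-- Induction on N: with q = exp t, the new factors multiply to 1 + q^(2N+1) - exp w q^N - exp (t -
w) q^N. The last two terms shift the summation index by one in each direction. -/
theorem hasSum_finite_triple_product {t : ℂ} (ht : t.re < 0) (w : ℂ) (N : ℕ) :
    HasSum (fun n : ℤ ↦ centralQBinom (exp t) N n *
        ((-1) ^ n * exp (t * (n * (n - 1)) / 2 + n * w)))
      ((∏ k ∈ Finset.range N, (1 - exp w * exp t ^ k)) *
        ∏ k ∈ Finset.range N, (1 - exp (t - w) * exp t ^ k)) := by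
  have hq := norm_exp_lt_one ht
  have hq0 := exp_ne_zero t
  induction N with
  | zero =>
    have h : ∀ n : ℤ, n ≠ 0 → centralQBinom (exp t) 0 n *
        ((-1) ^ n * exp (t * (n * (n - 1)) / 2 + n * w)) = 0 := fun n hn ↦ by
      rcases lt_or_gt_of_ne hn with h | h
      · simp [centralQBinom, qFactInv, not_le.2 h]
      · simp [centralQBinom, qFactInv, not_le.2 h]
    simpa [centralQBinom, qFactInv, qFact] using hasSum_single 0 h
  | succ N ih =>
    have h1 := (Equiv.subRight (1 : ℤ)).hasSum_iff.2 ih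
    have h2 := (Equiv.addRight (1 : ℤ)).hasSum_iff.2 ih
    have H := ((ih.mul_left (1 + exp t ^ (2 * N + 1))).sub
      (h1.mul_left (exp w * exp t ^ N))).sub (h2.mul_left (exp (t - w) * exp t ^ N))
    have e : (∏ k ∈ Finset.range (N + 1), (1 - exp w * exp t ^ k)) *
        (∏ k ∈ Finset.range (N + 1), (1 - exp (t - w) * exp t ^ k)) =
        (1 + exp t ^ (2 * N + 1)) * ((∏ k ∈ Finset.range N, (1 - exp w * exp t ^ k)) *
          ∏ k ∈ Finset.range N, (1 - exp (t - w) * exp t ^ k)) -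
        exp w * exp t ^ N * ((∏ k ∈ Finset.range N, (1 - exp w * exp t ^ k)) *
          ∏ k ∈ Finset.range N, (1 - exp (t - w) * exp t ^ k)) -
        exp (t - w) * exp t ^ N * ((∏ k ∈ Finset.range N, (1 - exp w * exp t ^ k)) *
          ∏ k ∈ Finset.range N, (1 - exp (t - w) * exp t ^ k)) := by
      have : exp w * exp (t - w) = exp t := by rw [← exp_add]; ring_nf
      rw [Finset.prod_range_succ, Finset.prod_range_succ]
      linear_combination ((∏ k ∈ Finset.range N, (1 - exp w * exp t ^ k)) *
          ∏ k ∈ Finset.range N, (1 - exp (t - w) * exp t ^ k)) * exp t ^ (2 * N) * this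
    rw [e]
    refine H.congr_fun fun n ↦ ?_
    have s1 : (-1 : ℂ) ^ (n - 1) = -(-1) ^ n := by rw [zpow_sub_one₀ (by norm_num)]; norm_num
    have s2 : (-1 : ℂ) ^ (n + 1) = -(-1) ^ n := by rw [zpow_add_one₀ (by norm_num)]; norm_num
    have e1 : exp w * exp t ^ N *
        exp (t * (((n - 1 : ℤ) : ℂ) * (((n - 1 : ℤ) : ℂ) - 1)) / 2 + ((n - 1 : ℤ) : ℂ) * w) =
        exp t ^ ((N : ℤ) + 1 - n) * exp (t * (n * (n - 1)) / 2 + n * w) := by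
      rw [← exp_nat_mul, ← exp_int_mul, ← exp_add, ← exp_add, ← exp_add]
      congr 1
      push_cast
      ring
    have e2 : exp (t - w) * exp t ^ N *
        exp (t * (((n + 1 : ℤ) : ℂ) * (((n + 1 : ℤ) : ℂ) - 1)) / 2 + ((n + 1 : ℤ) : ℂ) * w) =
        exp t ^ ((N : ℤ) + 1 + n) * exp (t * (n * (n - 1)) / 2 + n * w) := by
      rw [← exp_nat_mul, ← exp_int_mul, ← exp_add, ← exp_add, ← exp_add]
      congr 1
      push_cast
      ring
    simp only [Function.comp_apply, Equiv.subRight_apply, Equiv.coe_addRight]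
    rw [centralQBinom_succ hq hq0, s1, s2]
    linear_combination (-(-1) ^ n * centralQBinom (exp t) N (n - 1)) * e1 +
      (-(-1) ^ n * centralQBinom (exp t) N (n + 1)) * e2

theorem tendsto_qFactInv {q : ℂ} (hq : ‖q‖ < 1) {f : ℕ → ℤ}
    (hf : Tendsto f atTop atTop) :
    Tendsto (fun N ↦ qFactInv q (f N)) atTop (𝓝 (qPochInf q q)⁻¹) := by
  have h1 : Tendsto (fun N ↦ (f N).toNat) atTop atTop :=
    tendsto_atTop.2 fun b ↦ (hf.eventually_ge_atTop (b : ℤ)).mono fun N h ↦ by omega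
  have h2 := ((tendsto_qPochInf q hq).inv₀ (qPochInf_ne_zero_of_norm_lt hq hq)).comp h1
  refine h2.congr' ((hf.eventually_ge_atTop 0).mono fun N h ↦ ?_)
  simp [qFactInv, h, qFact]

theorem tendsto_centralQBinom {q : ℂ} (hq : ‖q‖ < 1) (n : ℤ) :
    Tendsto (fun N ↦ centralQBinom q N n) atTop (𝓝 (qPochInf q q)⁻¹) := by
  have h0 := qPochInf_ne_zero_of_norm_lt hq hq
  have h1 : Tendsto (fun N : ℕ ↦ qFact q (2 * N)) atTop (𝓝 (qPochInf q q)) :=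
    (tendsto_qPochInf q hq).comp (tendsto_id.const_mul_atTop' two_pos)
  have h2 := tendsto_qFactInv hq (f := fun N ↦ (N : ℤ) + n)
    (tendsto_atTop_add_const_right _ _ tendsto_natCast_atTop_atTop)
  have h3 := tendsto_qFactInv hq (f := fun N ↦ (N : ℤ) - n)
    (tendsto_atTop_add_const_right _ _ tendsto_natCast_atTop_atTop)
  have := (h1.mul h2).mul h3
  rwa [mul_inv_cancel₀ h0, one_mul] at this

/-- A bound uniform in both N and n, as needed for dominated convergence in the limit of the finite
identity. -/
theorem exists_norm_centralQBinom_le {q : ℂ} (hq : ‖q‖ < 1) :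
    ∃ M, ∀ N n, ‖centralQBinom q N n‖ ≤ M := by
  have h0 := qPochInf_ne_zero_of_norm_lt hq hq
  obtain ⟨C, hC⟩ := (tendsto_qPochInf q hq).norm.bddAbove_range
  obtain ⟨D, hD⟩ := ((tendsto_qPochInf q hq).inv₀ h0).norm.bddAbove_range
  have hC' : ∀ m, ‖qFact q m‖ ≤ C := fun m ↦ hC ⟨m, rfl⟩
  have hD0 : 0 ≤ D := (norm_nonneg _).trans (hD ⟨0, rfl⟩)
  have hD' : ∀ m, ‖qFactInv q m‖ ≤ D := fun m ↦ by
    unfold qFactInv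
    split_ifs
    · exact hD ⟨m.toNat, rfl⟩
    · simpa using hD0
  refine ⟨C * D * D, fun N n ↦ ?_⟩
  rw [centralQBinom, norm_mul, norm_mul]
  have hC0 : 0 ≤ C := (norm_nonneg _).trans (hC' 0)
  gcongr
  exacts [hC' _, hD' _, hD' _]

/-- The Jacobi triple product identity. -/
theorem thetaSeries_zero_eq_product {t : ℂ} (ht : t.re < 0) (w : ℂ) :
    thetaSeries 0 w t = exp (t / 8 - w / 2) *
      (qPochInf (exp w) (exp t) * qPochInf (exp (t - w)) (exp t) *
        qPochInf (exp t) (exp t)) := by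
  have hq := norm_exp_lt_one ht
  have h0 := qPochInf_ne_zero_of_norm_lt hq hq
  have e : ∀ n : ℤ, thetaTerm 0 w t n = exp (t / 8 - w / 2) *
      ((-1) ^ n * exp (t * (n * (n - 1)) / 2 + n * w)) := fun n ↦ by
    rw [thetaTerm, pow_zero, mul_one, mul_left_comm, ← exp_add]
    congr 2
    ring
  have hs : Summable fun n : ℤ ↦ ‖(-1) ^ n * exp (t * (n * (n - 1)) / 2 + n * w)‖ := by
    have h := summable_norm_thetaTerm 0 w ht
    simp only [e] at h
    simp only [norm_mul (exp _)] at h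
    exact (summable_mul_left_iff (norm_ne_zero_iff.2 (exp_ne_zero _))).1 h
  obtain ⟨M, hM⟩ := exists_norm_centralQBinom_le hq
  have T1 := tendsto_tsum_of_dominated_convergence (𝓕 := atTop)
    (f := fun N n ↦ centralQBinom (exp t) N n *
        ((-1) ^ n * exp (t * (n * (n - 1)) / 2 + n * w)))
    (g := fun n ↦ (qPochInf (exp t) (exp t))⁻¹ *
        ((-1) ^ n * exp (t * (n * (n - 1)) / 2 + n * w))) (hs.mul_left M)
    (fun n ↦ (tendsto_centralQBinom hq n).mul_const _)
    (.of_forall fun N n ↦ by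
      rw [norm_mul]
      gcongr
      exact hM N n)
  simp only [fun N ↦ (hasSum_finite_triple_product ht w N).tsum_eq] at T1
  have T2 := tendsto_nhds_unique T1
    ((tendsto_qPochInf (exp w) hq).mul (tendsto_qPochInf (exp (t - w)) hq))
  rw [tsum_mul_left, inv_mul_eq_iff_eq_mul₀ h0] at T2
  rw [thetaSeries, tsum_congr e, tsum_mul_left, T2]
  ring

/-- In the triple product only the factor 1 - exp w vanishes at w = 0, so the derivative there is -1
times the remaining factors. -/
theorem thetaSeries_one_zero {t : ℂ} (ht : t.re < 0) :
    thetaSeries 1 0 t = -exp (t / 8) * qPochInf (exp t) (exp t) ^ 3 := by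
  have hq := norm_exp_lt_one ht
  have e : ∀ w, thetaSeries 0 w t = (1 - exp w) * (exp (t / 8 - w / 2) *
      (qPochInf (exp w * exp t) (exp t) * qPochInf (exp (t - w)) (exp t) *
        qPochInf (exp t) (exp t))) := fun w ↦ by
    rw [thetaSeries_zero_eq_product ht, qPochInf_eq_mul (exp w) hq]; ring
  have d : DifferentiableAt ℂ (fun w ↦ exp (t / 8 - w / 2) *
      (qPochInf (exp w * exp t) (exp t) * qPochInf (exp (t - w)) (exp t) *
        qPochInf (exp t) (exp t))) 0 := by
    have h1 : DifferentiableAt ℂ (fun w ↦ qPochInf (exp w * exp t) (exp t)) 0 :=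
      (differentiable_qPochInf hq _).comp (0 : ℂ) (f := fun w ↦ exp w * exp t) (by fun_prop)
    have h2 : DifferentiableAt ℂ (fun w ↦ qPochInf (exp (t - w)) (exp t)) 0 :=
      (differentiable_qPochInf hq _).comp (0 : ℂ) (f := fun w ↦ exp (t - w)) (by fun_prop)
    fun_prop
  have h := ((hasDerivAt_exp (0 : ℂ)).const_sub 1).mul d.hasDerivAt
  have := (hasDerivAt_thetaSeries_left 0 ht 0).unique
    (h.congr_of_eventuallyEq (.of_forall e))
  rw [this]
  simp
  ring

/-! ### The Eisenstein series as a Taylor coefficient of theta. -/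

theorem tsum_mul_pow_div_one_sub_pow {q : ℂ} (hq : ‖q‖ < 1) :
    ∑' n : ℕ, ((n : ℂ) + 1) * q ^ (n + 1) / (1 - q ^ (n + 1)) =
      ∑' n : ℕ, (∑ d ∈ (n + 1).divisors, (d : ℂ)) * q ^ (n + 1) := by
  have h := tsum_pow_div_one_sub_eq_tsum_sigma hq 1
  rw [tsum_pnat_eq_tsum_succ (f := fun n : ℕ ↦ (n : ℂ) ^ 1 * q ^ n / (1 - q ^ n)),
    tsum_pnat_eq_tsum_succ (f := fun n : ℕ ↦ (ArithmeticFunction.sigma 1 n : ℂ) * q ^ n)] at h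
  simpa [ArithmeticFunction.sigma_one_apply] using h

/-- The logarithmic derivative of `(q; q)_∞` is an Eisenstein series. -/
theorem hasDerivAt_qPochInf_self {q : ℂ} (hq : ‖q‖ < 1) :
    ∃ D, HasDerivAt (fun q ↦ qPochInf q q) D q ∧ q * D = qPochInf q q * ((eisE2 q - 1) / 24) := by
  have e : (fun q : ℂ ↦ qPochInf q q) = fun q ↦ ∏' n : ℕ, (1 - q ^ (n + 1)) := by
    ext q; simp only [qPochInf, pow_succ']
  have hmem : q ∈ Metric.ball (0 : ℂ) 1 := by simpa using hq
  have hd : DifferentiableAt ℂ (fun q ↦ qPochInf q q) q := by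
    rw [e]
    exact ModularForm.differentiableOn_tprod_one_sub_pow.differentiableAt
      (Metric.isOpen_ball.mem_nhds hmem)
  have h0 := qPochInf_ne_zero_of_norm_lt hq hq
  have h0' : ∏' n : ℕ, (1 - q ^ (n + 1)) ≠ 0 := by simpa only [qPochInf, pow_succ'] using h0
  refine ⟨_, hd.hasDerivAt, ?_⟩
  have hne : ∀ i : ℕ, 1 - q ^ (i + 1) ≠ 0 := fun i ↦ by
    rw [pow_succ']; exact one_sub_pow_ne_zero hq i
  have hl : ∀ i : ℕ, q * logDeriv (fun q ↦ 1 - q ^ (i + 1)) q =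
      -((i + 1) * q ^ (i + 1) / (1 - q ^ (i + 1))) := fun i ↦ by
    have := (hasDerivAt_pow (i + 1) q).const_sub 1
    rw [logDeriv_apply, this.deriv, pow_succ' q i]
    push_cast
    ring
  -- At q = 0 both sides vanish because E₂(0) = 1. The termwise argument below cancels a factor q.
  rcases eq_or_ne q 0 with rfl | hq0
  · simp [eisE2]
  have hsum : Summable fun i : ℕ ↦ logDeriv (fun q : ℂ ↦ 1 - q ^ (i + 1)) q := by
    refine (summable_mul_left_iff hq0).1 ?_
    simp only [hl]
    have := (summable_nat_add_iff (f := fun n : ℕ ↦ (n : ℂ) ^ 1 * q ^ n / (1 - q ^ n)) 1).2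
      (summable_norm_pow_mul_geometric_div_one_sub 1 hq)
    simpa using this.neg
  have H := logDeriv_tprod_eq_tsum (s := Metric.ball (0 : ℂ) 1) Metric.isOpen_ball hmem
    (f := fun (i : ℕ) (q : ℂ) ↦ 1 - q ^ (i + 1)) hne
    (fun i ↦ by fun_prop) hsum ModularForm.multipliableLocallyUniformlyOn_one_sub_pow
    h0'
  rw [← e, logDeriv_apply] at H
  have H' : q * (deriv (fun q ↦ qPochInf q q) q / qPochInf q q) = (eisE2 q - 1) / 24 := by
    rw [H, ← tsum_mul_left, tsum_congr hl, tsum_neg, tsum_mul_pow_div_one_sub_pow hq, eisE2]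
    ring
  rw [← H']
  field_simp

/-- The third Taylor coefficient of the theta function at the origin. -/
theorem thetaSeries_three_zero {t : ℂ} (ht : t.re < 0) :
    thetaSeries 3 0 t = thetaSeries 1 0 t * (eisE2 (exp t) / 4) := by
  obtain ⟨D, hD, hD'⟩ := hasDerivAt_qPochInf_self (norm_exp_lt_one ht)
  -- The heat equation gives d/dt θ'(0) = θ'''(0)/2. The product formula gives logarithmic
  -- derivative 1/8 + 3(E₂ - 1)/24 = E₂/8.
  have h1 := hasDerivAt_thetaSeries 1 0 0 1 0 (s := t) (by simpa using ht)
  simp only [zero_mul, one_mul, add_zero, zero_add] at h1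
  have h2 := (((hasDerivAt_id t).div_const 8).cexp.neg).mul ((hD.comp t (hasDerivAt_exp t)).pow 3)
  have h3 : thetaSeries 1 0 =ᶠ[𝓝 t] fun t ↦ -exp (t / 8) * qPochInf (exp t) (exp t) ^ 3 :=
    (continuous_re.continuousAt.eventually_lt continuousAt_const ht).mono
      fun t ht ↦ thetaSeries_one_zero ht
  have h4 := h1.unique (h2.congr_of_eventuallyEq h3)
  simp only [Function.comp_apply, Pi.neg_apply, Pi.pow_apply, id] at h4
  rw [thetaSeries_one_zero ht]
  push_cast at h4
  linear_combination 2 * h4 - 6 * exp (t / 8) * qPochInf (exp t) (exp t) ^ 2 * hD'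

/-! ### Logarithmic derivatives and their addition law. -/

/-- The logarithmic derivative `θ' / θ`. -/
noncomputable def thetaLogOne (w t : ℂ) : ℂ := thetaSeries 1 w t / thetaSeries 0 w t

/-- The second logarithmic derivative of the theta function. -/
noncomputable def thetaLogTwo (w t : ℂ) : ℂ :=
  thetaSeries 2 w t / thetaSeries 0 w t - (thetaSeries 1 w t / thetaSeries 0 w t) ^ 2

/-- The third logarithmic derivative of the theta function. -/
noncomputable def thetaLogThree (w t : ℂ) : ℂ :=
  thetaSeries 3 w t / thetaSeries 0 w t
    - 3 * (thetaSeries 1 w t / thetaSeries 0 w t) * (thetaSeries 2 w t / thetaSeries 0 w t)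
    + 2 * (thetaSeries 1 w t / thetaSeries 0 w t) ^ 3

/-- The fourth logarithmic derivative of the theta function. -/
noncomputable def thetaLogFour (w t : ℂ) : ℂ :=
  thetaSeries 4 w t / thetaSeries 0 w t
    - 4 * (thetaSeries 1 w t / thetaSeries 0 w t) * (thetaSeries 3 w t / thetaSeries 0 w t)
    - 3 * (thetaSeries 2 w t / thetaSeries 0 w t) ^ 2
    + 12 * (thetaSeries 1 w t / thetaSeries 0 w t) ^ 2 * (thetaSeries 2 w t / thetaSeries 0 w t)
    - 6 * (thetaSeries 1 w t / thetaSeries 0 w t) ^ 4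

section

variable {a b c d s : ℂ}

theorem hasDerivAt_thetaSeries_ratio (k : ℕ) (hs : (c * s + d).re < 0)
    (h0 : thetaSeries 0 (a * s + b) (c * s + d) ≠ 0) :
    HasDerivAt (fun s ↦ thetaSeries k (a * s + b) (c * s + d) /
        thetaSeries 0 (a * s + b) (c * s + d))
      (a * (thetaSeries (k + 1) (a * s + b) (c * s + d) / thetaSeries 0 (a * s + b) (c * s + d)) +
        c / 2 * (thetaSeries (k + 2) (a * s + b) (c * s + d) /
          thetaSeries 0 (a * s + b) (c * s + d)) -
        thetaSeries k (a * s + b) (c * s + d) / thetaSeries 0 (a * s + b) (c * s + d) *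
          (a * (thetaSeries 1 (a * s + b) (c * s + d) / thetaSeries 0 (a * s + b) (c * s + d)) +
            c / 2 * (thetaSeries 2 (a * s + b) (c * s + d) /
              thetaSeries 0 (a * s + b) (c * s + d)))) s := by
  refine ((hasDerivAt_thetaSeries k a b c d hs).div
    (hasDerivAt_thetaSeries 0 a b c d hs) h0).congr_deriv ?_
  simp only [zero_add]
  field_simp

theorem hasDerivAt_thetaLogOne (hs : (c * s + d).re < 0)
    (h0 : thetaSeries 0 (a * s + b) (c * s + d) ≠ 0) :
    HasDerivAt (fun s ↦ thetaLogOne (a * s + b) (c * s + d))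
      (a * thetaLogTwo (a * s + b) (c * s + d) + c / 2 * (thetaLogThree (a * s + b) (c * s + d) +
        2 * thetaLogOne (a * s + b) (c * s + d) * thetaLogTwo (a * s + b) (c * s + d))) s := by
  refine (hasDerivAt_thetaSeries_ratio 1 hs h0).congr_deriv ?_
  simp only [thetaLogOne, thetaLogTwo, thetaLogThree, Nat.reduceAdd]
  ring

theorem hasDerivAt_thetaLogTwo (hs : (c * s + d).re < 0)
    (h0 : thetaSeries 0 (a * s + b) (c * s + d) ≠ 0) :
    HasDerivAt (fun s ↦ thetaLogTwo (a * s + b) (c * s + d))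
      (a * thetaLogThree (a * s + b) (c * s + d) + c / 2 * (thetaLogFour (a * s + b) (c * s + d) +
        2 * thetaLogTwo (a * s + b) (c * s + d) ^ 2 +
        2 * thetaLogOne (a * s + b) (c * s + d) * thetaLogThree (a * s + b) (c * s + d))) s := by
  refine ((hasDerivAt_thetaSeries_ratio 2 hs h0).sub
    ((hasDerivAt_thetaSeries_ratio 1 hs h0).pow 2)).congr_deriv ?_
  simp only [thetaLogOne, thetaLogTwo, thetaLogThree, thetaLogFour, Nat.reduceAdd]
  push_cast
  ring

end

section

variable {t : ℂ}

theorem hasDerivAt_thetaLogOne_left (ht : t.re < 0) (b : ℂ) {w : ℂ}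
    (h0 : thetaSeries 0 (w + b) t ≠ 0) :
    HasDerivAt (fun w ↦ thetaLogOne (w + b) t) (thetaLogTwo (w + b) t) w := by
  simpa using hasDerivAt_thetaLogOne (a := 1) (b := b) (c := 0) (d := t) (s := w)
    (by simpa using ht) (by simpa using h0)

theorem hasDerivAt_thetaLogTwo_left (ht : t.re < 0) (b : ℂ) {w : ℂ}
    (h0 : thetaSeries 0 (w + b) t ≠ 0) :
    HasDerivAt (fun w ↦ thetaLogTwo (w + b) t) (thetaLogThree (w + b) t) w := by
  simpa using hasDerivAt_thetaLogTwo (a := 1) (b := b) (c := 0) (d := t) (s := w)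
    (by simpa using ht) (by simpa using h0)

theorem hasDerivAt_thetaLogThree_left (ht : t.re < 0) (b : ℂ) {w : ℂ}
    (h0 : thetaSeries 0 (w + b) t ≠ 0) :
    HasDerivAt (fun w ↦ thetaLogThree (w + b) t) (thetaLogFour (w + b) t) w := by
  have R := fun k ↦ hasDerivAt_thetaSeries_ratio (a := 1) (b := b) (c := 0) (d := t) (s := w) k
    (by simpa using ht) (by simpa using h0)
  simp only [zero_mul, zero_add, one_mul, zero_div, add_zero] at R
  refine (((R 3).sub (((R 1).const_mul 3).mul (R 2))).add
    (((R 1).pow 3).const_mul 2)).congr_deriv ?_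
  simp only [thetaLogFour, Nat.reduceAdd]
  push_cast
  ring

theorem thetaSeries_one_zero_ne_zero (ht : t.re < 0) : thetaSeries 1 0 t ≠ 0 := by
  have hq := norm_exp_lt_one ht
  rw [thetaSeries_one_zero ht]
  exact mul_ne_zero (neg_ne_zero.2 (exp_ne_zero _)) (pow_ne_zero _ (qPochInf_ne_zero_of_norm_lt hq hq))

variable {A B : ℂ}

/-- The relation `(ζ (A) + ζ (B) - ζ (A + B)) ^ 2 = ℘ (A) + ℘ (B) + ℘ (A + B)`. -/
theorem thetaLog_square (ht : t.re < 0) (hA : thetaSeries 0 A t ≠ 0)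
    (hB : thetaSeries 0 B t ≠ 0) (hS : thetaSeries 0 (A + B) t ≠ 0) :
    (thetaLogOne A t + thetaLogOne B t - thetaLogOne (A + B) t) ^ 2 =
      eisE2 (exp t) / 4 - thetaLogTwo A t - thetaLogTwo B t - thetaLogTwo (A + B) t := by
  have hK := thetaSeries_one_zero_ne_zero ht
  have h := thetaSeries_square_addition A B ht hK
  rw [thetaSeries_three_zero ht, mul_div_cancel_left₀ _ hK] at h
  simp only [thetaLogOne, thetaLogTwo]
  field_simp
  linear_combination 4 * thetaSeries 0 A t * thetaSeries 0 B t * thetaSeries 0 (A + B) t * h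

theorem eventually_thetaSeries_ne_zero (ht : t.re < 0) (b : ℂ) {w : ℂ}
    (h0 : thetaSeries 0 (w + b) t ≠ 0) : ∀ᶠ w in 𝓝 w, thetaSeries 0 (w + b) t ≠ 0 :=
  (hasDerivAt_thetaSeries_comp 0 ht ((hasDerivAt_id w).add_const b)).continuousAt.eventually_ne h0

/-- The derivative of `thetaLog_square` in A with B fixed. The identity persists near A because
theta stays nonzero there. -/
theorem thetaLog_square_deriv (ht : t.re < 0) (hA : thetaSeries 0 A t ≠ 0)
    (hB : thetaSeries 0 B t ≠ 0) (hS : thetaSeries 0 (A + B) t ≠ 0) :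
    2 * (thetaLogOne A t + thetaLogOne B t - thetaLogOne (A + B) t) *
        (thetaLogTwo A t - thetaLogTwo (A + B) t) =
      -thetaLogThree A t - thetaLogThree (A + B) t := by
  have hA' : thetaSeries 0 (A + 0) t ≠ 0 := by rwa [add_zero]
  have h1 := (((hasDerivAt_thetaLogOne_left ht 0 hA').add_const (thetaLogOne B t)).sub
    (hasDerivAt_thetaLogOne_left ht B hS)).pow 2
  have h2 := (((hasDerivAt_thetaLogTwo_left ht 0 hA').const_sub (eisE2 (exp t) / 4)).sub_const
    (thetaLogTwo B t)).sub (hasDerivAt_thetaLogTwo_left ht B hS)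
  have h := h1.unique (h2.congr_of_eventuallyEq (by
    filter_upwards [eventually_thetaSeries_ne_zero ht 0 hA',
      eventually_thetaSeries_ne_zero ht B hS] with w hw hw'
    rw [add_zero] at hw
    simpa using thetaLog_square ht hw hB hw'))
  simp only [add_zero, Pi.sub_apply] at h
  push_cast at h
  linear_combination h

theorem thetaLog_square_deriv_deriv (ht : t.re < 0) (hA : thetaSeries 0 A t ≠ 0)
    (hB : thetaSeries 0 B t ≠ 0) (hS : thetaSeries 0 (A + B) t ≠ 0) :
    2 * (thetaLogTwo A t - thetaLogTwo (A + B) t) ^ 2 +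
      2 * (thetaLogOne A t + thetaLogOne B t - thetaLogOne (A + B) t) *
        (thetaLogThree A t - thetaLogThree (A + B) t) =
      -thetaLogFour A t - thetaLogFour (A + B) t := by
  have hA' : thetaSeries 0 (A + 0) t ≠ 0 := by rwa [add_zero]
  have h1 := ((((hasDerivAt_thetaLogOne_left ht 0 hA').add_const (thetaLogOne B t)).sub
    (hasDerivAt_thetaLogOne_left ht B hS)).const_mul 2).mul
    ((hasDerivAt_thetaLogTwo_left ht 0 hA').sub (hasDerivAt_thetaLogTwo_left ht B hS))
  have h2 := (hasDerivAt_thetaLogThree_left ht 0 hA').neg.sub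
    (hasDerivAt_thetaLogThree_left ht B hS)
  have h := h1.unique (h2.congr_of_eventuallyEq (by
    filter_upwards [eventually_thetaSeries_ne_zero ht 0 hA',
      eventually_thetaSeries_ne_zero ht B hS] with w hw hw'
    rw [add_zero] at hw
    simpa using thetaLog_square_deriv ht hw hB hw'))
  simp only [add_zero, Pi.sub_apply] at h
  linear_combination h

theorem thetaLogOne_neg (w t : ℂ) : thetaLogOne (-w) t = -thetaLogOne w t := by
  simp [thetaLogOne, thetaSeries_neg, div_neg]

theorem thetaLogTwo_neg (w t : ℂ) : thetaLogTwo (-w) t = thetaLogTwo w t := by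
  simp [thetaLogTwo, thetaSeries_neg, div_neg, neg_div, pow_succ]

theorem thetaSeries_two_add_period (w : ℂ) (ht : t.re < 0) :
    thetaSeries 2 (w + t) t = -exp (-t / 2 - w) *
      (thetaSeries 2 w t - 2 * thetaSeries 1 w t + thetaSeries 0 w t) := by
  have h := (((summable_thetaTerm 2 w ht).hasSum.sub
    ((summable_thetaTerm 1 w ht).hasSum.mul_left 2)).add (summable_thetaTerm 0 w ht).hasSum)
  unfold thetaSeries
  rw [← h.tsum_eq, ← (Equiv.subRight (1 : ℤ)).tsum_eq, ← tsum_mul_left]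
  refine tsum_congr fun n ↦ ?_
  rw [Equiv.subRight_apply, thetaTerm_add_period]
  simp only [thetaTerm]
  ring

theorem thetaLogOne_add_period (ht : t.re < 0) {w : ℂ} (h0 : thetaSeries 0 w t ≠ 0) :
    thetaLogOne (w + t) t = thetaLogOne w t - 1 := by
  have := exp_ne_zero (-t / 2 - w)
  rw [thetaLogOne, thetaLogOne, thetaSeries_one_add_period w ht, thetaSeries_zero_add_period]
  field_simp

theorem thetaLogTwo_add_period (ht : t.re < 0) {w : ℂ} (h0 : thetaSeries 0 w t ≠ 0) :
    thetaLogTwo (w + t) t = thetaLogTwo w t := by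
  have := exp_ne_zero (-t / 2 - w)
  rw [thetaLogTwo, thetaLogTwo, thetaSeries_one_add_period w ht, thetaSeries_zero_add_period,
    thetaSeries_two_add_period w ht]
  field_simp
  ring

end

/-! ### Seven-torsion points. -/

section

variable {s : ℂ}

theorem seven_mul_re_neg (hs : s.re < 0) : (7 * s).re < 0 := by
  have : (7 * s).re = 7 * s.re := by simp
  linarith

theorem norm_exp_natCast_mul_lt_one (hs : s.re < 0) (r : ℕ) (hr : r ≠ 0) :
    ‖exp (r * s)‖ < 1 := by
  rw [exp_nat_mul, norm_pow]
  exact pow_lt_one₀ (norm_nonneg _) (norm_exp_lt_one hs) hr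

/-- The product side of the triple product identity at the torsion points. -/
theorem thetaSeries_torsion_eq (hs : s.re < 0) (r r' : ℕ) (h : r + r' = 7) :
    thetaSeries 0 (r * s) (7 * s) = exp ((7 / 8 - r / 2) * s) *
      (qPochInf (exp s ^ r) (exp s ^ 7) * qPochInf (exp s ^ r') (exp s ^ 7) *
        qPochInf (exp s ^ 7) (exp s ^ 7)) := by
  have h' : (r : ℂ) + r' = 7 := by exact_mod_cast h
  have e1 : 7 * s - r * s = r' * s := by rw [← h']; ring
  have e2 : (7 : ℂ) * s = ((7 : ℕ) : ℂ) * s := by norm_num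
  rw [thetaSeries_zero_eq_product (seven_mul_re_neg hs), e1, e2, exp_nat_mul, exp_nat_mul,
    exp_nat_mul]
  congr 2
  push_cast
  ring

theorem thetaSeries_torsion_ne_zero (hs : s.re < 0) (r r' : ℕ) (h : r + r' = 7)
    (hr : r ≠ 0) (hr' : r' ≠ 0) : thetaSeries 0 (r * s) (7 * s) ≠ 0 := by
  have h7 := norm_exp_natCast_mul_lt_one hs 7 (by norm_num)
  have h1 := norm_exp_natCast_mul_lt_one hs r hr
  have h2 := norm_exp_natCast_mul_lt_one hs r' hr'
  rw [exp_nat_mul] at h7 h1 h2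
  rw [thetaSeries_torsion_eq hs r r' h]
  exact mul_ne_zero (exp_ne_zero _) (mul_ne_zero (mul_ne_zero (qPochInf_ne_zero_of_norm_lt h7 h1)
    (qPochInf_ne_zero_of_norm_lt h7 h2)) (qPochInf_ne_zero_of_norm_lt h7 h7))

theorem theta_one_ne_zero (hs : s.re < 0) : thetaSeries 0 s (7 * s) ≠ 0 := by
  simpa using thetaSeries_torsion_ne_zero hs 1 6 rfl (by norm_num) (by norm_num)

theorem theta_two_ne_zero (hs : s.re < 0) : thetaSeries 0 (2 * s) (7 * s) ≠ 0 := by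
  simpa using thetaSeries_torsion_ne_zero hs 2 5 rfl (by norm_num) (by norm_num)

theorem theta_three_ne_zero (hs : s.re < 0) : thetaSeries 0 (3 * s) (7 * s) ≠ 0 := by
  simpa using thetaSeries_torsion_ne_zero hs 3 4 rfl (by norm_num) (by norm_num)

theorem theta_reflect (r : ℂ) :
    thetaSeries 0 ((7 - r) * s) (7 * s) = exp ((r - 7 / 2) * s) * thetaSeries 0 (r * s) (7 * s) := by
  have := thetaSeries_zero_add_period (-(r * s)) (7 * s)
  rw [thetaSeries_neg] at this
  rw [show (7 - r) * s = -(r * s) + 7 * s by ring, this,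
    show -(7 * s) / 2 - -(r * s) = (r - 7 / 2) * s by ring]
  ring

theorem thetaLogOne_reflect (hs : s.re < 0) {r : ℂ} (h0 : thetaSeries 0 (r * s) (7 * s) ≠ 0) :
    thetaLogOne ((7 - r) * s) (7 * s) = -thetaLogOne (r * s) (7 * s) - 1 := by
  rw [show (7 - r) * s = -(r * s) + 7 * s by ring, thetaLogOne_add_period (seven_mul_re_neg hs),
    thetaLogOne_neg]
  rw [thetaSeries_neg]
  simpa using h0

theorem thetaLogTwo_reflect (hs : s.re < 0) {r : ℂ} (h0 : thetaSeries 0 (r * s) (7 * s) ≠ 0) :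
    thetaLogTwo ((7 - r) * s) (7 * s) = thetaLogTwo (r * s) (7 * s) := by
  rw [show (7 - r) * s = -(r * s) + 7 * s by ring, thetaLogTwo_add_period (seven_mul_re_neg hs),
    thetaLogTwo_neg]
  rw [thetaSeries_neg]
  simpa using h0

theorem theta_four_ne_zero (hs : s.re < 0) : thetaSeries 0 (4 * s) (7 * s) ≠ 0 := by
  simpa using thetaSeries_torsion_ne_zero hs 4 3 rfl (by norm_num) (by norm_num)

theorem theta_six_ne_zero (hs : s.re < 0) : thetaSeries 0 (6 * s) (7 * s) ≠ 0 := by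
  simpa using thetaSeries_torsion_ne_zero hs 6 1 rfl (by norm_num) (by norm_num)

/-- The normalised logarithmic derivatives at the torsion points; they are modular forms of
weight one. -/
noncomputable def torsionZeta (r s : ℂ) : ℂ := thetaLogOne (r * s) (7 * s) + r / 7

/-- The moving point contributes r ζ' and the heat equation 7 ζ ζ'. Together they are 7 (ζ + r/7)
ζ', which explains the shift r/7. The same shift makes `torsionZeta` odd under r ↦ 7 - r. -/
theorem hasDerivAt_torsionZeta (hs : s.re < 0) (r : ℂ)
    (h0 : thetaSeries 0 (r * s) (7 * s) ≠ 0) :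
    HasDerivAt (torsionZeta r) (7 / 2 * thetaLogThree (r * s) (7 * s) +
      7 * torsionZeta r s * thetaLogTwo (r * s) (7 * s)) s := by
  have h := hasDerivAt_thetaLogOne (a := r) (b := 0) (c := 7) (d := 0) (s := s)
    (by simpa using seven_mul_re_neg hs) (by simpa using h0)
  simp only [add_zero] at h
  refine (h.add_const (r / 7)).congr_deriv ?_
  rw [torsionZeta]
  ring

theorem hasDerivAt_torsion_thetaLogTwo (hs : s.re < 0) (r : ℂ)
    (h0 : thetaSeries 0 (r * s) (7 * s) ≠ 0) :
    HasDerivAt (fun s ↦ thetaLogTwo (r * s) (7 * s)) (7 / 2 * thetaLogFour (r * s) (7 * s) +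
      7 * thetaLogTwo (r * s) (7 * s) ^ 2 +
      7 * torsionZeta r s * thetaLogThree (r * s) (7 * s)) s := by
  have h := hasDerivAt_thetaLogTwo (a := r) (b := 0) (c := 7) (d := 0) (s := s)
    (by simpa using seven_mul_re_neg hs) (by simpa using h0)
  simp only [add_zero] at h
  refine h.congr_deriv ?_
  rw [torsionZeta]
  ring

/-- Doubling permutes the torsion points up to sign and period: 1 ↦ 2 ↦ 4 ≡ -3, and 3 ↦ 6 ≡ -1. The
three doubling cases form a cyclic linear system for the second logarithmic derivatives. -/
theorem torsion_square_one (hs : s.re < 0) :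
    2 * thetaLogTwo (1 * s) (7 * s) + thetaLogTwo (2 * s) (7 * s) =
      eisE2 (exp (7 * s)) / 4 - (2 * torsionZeta 1 s - torsionZeta 2 s) ^ 2 := by
  have h := thetaLog_square (A := s) (B := s) (seven_mul_re_neg hs) (theta_one_ne_zero hs)
    (theta_one_ne_zero hs) (by rw [← two_mul]; exact theta_two_ne_zero hs)
  rw [← two_mul s] at h
  simp only [torsionZeta, one_mul]
  linear_combination h

theorem torsion_square_two (hs : s.re < 0) :
    2 * thetaLogTwo (2 * s) (7 * s) + thetaLogTwo (3 * s) (7 * s) =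
      eisE2 (exp (7 * s)) / 4 - (2 * torsionZeta 2 s + torsionZeta 3 s) ^ 2 := by
  have e : 2 * s + 2 * s = 4 * s := by ring
  have h := thetaLog_square (A := 2 * s) (B := 2 * s) (seven_mul_re_neg hs) (theta_two_ne_zero hs)
    (theta_two_ne_zero hs) (by rw [e]; exact theta_four_ne_zero hs)
  rw [e, show (4 : ℂ) = 7 - 3 by norm_num, thetaLogOne_reflect hs (theta_three_ne_zero hs),
    thetaLogTwo_reflect hs (theta_three_ne_zero hs)] at h
  simp only [torsionZeta]
  linear_combination h

theorem torsion_square_three (hs : s.re < 0) :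
    2 * thetaLogTwo (3 * s) (7 * s) + thetaLogTwo (1 * s) (7 * s) =
      eisE2 (exp (7 * s)) / 4 - (2 * torsionZeta 3 s + torsionZeta 1 s) ^ 2 := by
  have e : 3 * s + 3 * s = 6 * s := by ring
  have h1 : thetaSeries 0 (1 * s) (7 * s) ≠ 0 := by simpa using theta_one_ne_zero hs
  have h := thetaLog_square (A := 3 * s) (B := 3 * s) (seven_mul_re_neg hs)
    (theta_three_ne_zero hs) (theta_three_ne_zero hs) (by rw [e]; exact theta_six_ne_zero hs)
  rw [e, show (6 : ℂ) = 7 - 1 by norm_num, thetaLogOne_reflect hs h1,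
    thetaLogTwo_reflect hs h1] at h
  simp only [torsionZeta]
  linear_combination h

/-- The doubling relations add up to three times this left side. The compatibility condition is a
quadratic relation among the `torsionZeta` values. -/
theorem torsion_square_mixed (hs : s.re < 0) :
    thetaLogTwo (1 * s) (7 * s) + thetaLogTwo (2 * s) (7 * s) + thetaLogTwo (3 * s) (7 * s) =
      eisE2 (exp (7 * s)) / 4 - (torsionZeta 1 s + torsionZeta 2 s - torsionZeta 3 s) ^ 2 := by
  have e : s + 2 * s = 3 * s := by ring
  have h := thetaLog_square (A := s) (B := 2 * s) (seven_mul_re_neg hs) (theta_one_ne_zero hs)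
    (theta_two_ne_zero hs) (by rw [e]; exact theta_three_ne_zero hs)
  rw [e] at h
  simp only [torsionZeta, one_mul]
  linear_combination h

/-- The relations between second, third and fourth logarithmic derivatives at the points
`r s` and `(r + r') s`. -/
theorem torsion_derivs (hs : s.re < 0) {r r' r'' : ℂ} (hr : r + r' = r'')
    (h : thetaSeries 0 (r * s) (7 * s) ≠ 0) (h' : thetaSeries 0 (r' * s) (7 * s) ≠ 0)
    (h'' : thetaSeries 0 (r'' * s) (7 * s) ≠ 0) :
    2 * (torsionZeta r s + torsionZeta r' s - torsionZeta r'' s) *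
        (thetaLogTwo (r * s) (7 * s) - thetaLogTwo (r'' * s) (7 * s)) =
      -thetaLogThree (r * s) (7 * s) - thetaLogThree (r'' * s) (7 * s) ∧
    2 * (thetaLogTwo (r * s) (7 * s) - thetaLogTwo (r'' * s) (7 * s)) ^ 2 +
      2 * (torsionZeta r s + torsionZeta r' s - torsionZeta r'' s) *
        (thetaLogThree (r * s) (7 * s) - thetaLogThree (r'' * s) (7 * s)) =
      -thetaLogFour (r * s) (7 * s) - thetaLogFour (r'' * s) (7 * s) := by
  subst hr
  have e : (r + r') * s = r * s + r' * s := by ring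
  rw [e] at h''
  have h1 := thetaLog_square_deriv (seven_mul_re_neg hs) h h' h''
  have h2 := thetaLog_square_deriv_deriv (seven_mul_re_neg hs) h h' h''
  simp only [torsionZeta, e]
  exact ⟨by linear_combination h1, by linear_combination h2⟩

theorem theta_five_ne_zero (hs : s.re < 0) : thetaSeries 0 (5 * s) (7 * s) ≠ 0 := by
  simpa using thetaSeries_torsion_ne_zero hs 5 2 rfl (by norm_num) (by norm_num)

theorem thetaLog_addition {A B C t : ℂ} (ht : t.re < 0) (hA : thetaSeries 0 A t ≠ 0)
    (hB : thetaSeries 0 B t ≠ 0) (hC : thetaSeries 0 C t ≠ 0)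
    (hS : thetaSeries 0 (A + B + C) t ≠ 0) :
    thetaLogOne A t + thetaLogOne B t + thetaLogOne C t - thetaLogOne (A + B + C) t =
      thetaSeries 1 0 t * (thetaSeries 0 (A + B) t * thetaSeries 0 (B + C) t *
        thetaSeries 0 (A + C) t) / (thetaSeries 0 A t * thetaSeries 0 B t * thetaSeries 0 C t *
          thetaSeries 0 (A + B + C) t) := by
  rw [thetaSeries_logDeriv_addition A B C ht]
  simp only [thetaLogOne]
  field_simp
  ring

/-- The triple (A, B, C) = (s, s, 2s) is chosen for cancellation: since θ(4s) is a multiple of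
θ(3s), the quotient collapses to θ(3s)/θ(s)². The triples (2s, 2s, 4s) and (3s, 3s, -s) play the
same role in the two companion lemmas. -/
theorem torsion_addition_one (hs : s.re < 0) :
    -(2 * torsionZeta 1 s + torsionZeta 2 s + torsionZeta 3 s) =
      -thetaSeries 1 0 (7 * s) * exp (1 / 2 * s) *
        (thetaSeries 0 (3 * s) (7 * s) / thetaSeries 0 s (7 * s) ^ 2) := by
  have n1 := theta_one_ne_zero hs
  have n2 := theta_two_ne_zero hs
  have n3 := theta_three_ne_zero hs
  have h := thetaLog_addition (A := s) (B := s) (C := 2 * s) (seven_mul_re_neg hs) n1 n1 n2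
    (by rw [show s + s + 2 * s = 4 * s by ring]; exact theta_four_ne_zero hs)
  rw [show s + s = 2 * s by ring, show s + 2 * s = 3 * s by ring,
    show 2 * s + 2 * s = (7 - 3) * s by ring, thetaLogOne_reflect hs n3, theta_reflect 3,
    show (3 - 7 / 2) * s = -(1 / 2 * s) by ring, exp_neg] at h
  have hE := exp_ne_zero (1 / 2 * s)
  have hl : -(2 * torsionZeta 1 s + torsionZeta 2 s + torsionZeta 3 s) =
      -(thetaLogOne s (7 * s) + thetaLogOne s (7 * s) + thetaLogOne (2 * s) (7 * s) -
        (-thetaLogOne (3 * s) (7 * s) - 1)) := by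
    simp only [torsionZeta, one_mul]; ring
  rw [hl, h]
  generalize thetaSeries 0 (3 * s) (7 * s) = θ₃ at *
  generalize thetaSeries 0 (2 * s) (7 * s) = θ₂ at *
  generalize exp (1 / 2 * s) = E at *
  field_simp

theorem torsion_addition_two (hs : s.re < 0) :
    2 * torsionZeta 2 s - torsionZeta 1 s - torsionZeta 3 s =
      -thetaSeries 1 0 (7 * s) * exp (-(1 / 2 * s)) *
        (thetaSeries 0 s (7 * s) / thetaSeries 0 (2 * s) (7 * s) ^ 2) := by
  have n1 := theta_one_ne_zero hs
  have n1' : thetaSeries 0 (1 * s) (7 * s) ≠ 0 := by rwa [one_mul]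
  have n2 := theta_two_ne_zero hs
  have n3 := theta_three_ne_zero hs
  have t8 := thetaSeries_zero_add_period s (7 * s)
  have h := thetaLog_addition (A := 2 * s) (B := 2 * s) (C := 4 * s) (seven_mul_re_neg hs) n2 n2
    (theta_four_ne_zero hs)
    (by rw [show 2 * s + 2 * s + 4 * s = s + 7 * s by ring, t8]
        exact mul_ne_zero (neg_ne_zero.2 (exp_ne_zero _)) n1)
  rw [show 2 * s + 2 * s + 4 * s = s + 7 * s by ring, show 2 * s + 2 * s = (7 - 3) * s by ring,
    show 2 * s + 4 * s = (7 - 1) * s by ring, show 4 * s = (7 - 3) * s by ring,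
    thetaLogOne_reflect hs n3, theta_reflect 3, theta_reflect 1, one_mul, t8,
    thetaLogOne_add_period (seven_mul_re_neg hs) n1,
    show (3 - 7 / 2) * s = -(1 / 2 * s) by ring,
    -- The exponents -5s/2 and -9s/2 are split into copies of -s/2, so that all exponentials become
    -- powers of one variable.
    show (1 - 7 / 2) * s = -(1 / 2 * s) + -(1 / 2 * s) + -(1 / 2 * s) + -(1 / 2 * s)
      + -(1 / 2 * s) by ring,
    show -(7 * s) / 2 - s = -(1 / 2 * s) + -(1 / 2 * s) + -(1 / 2 * s) + -(1 / 2 * s)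
      + -(1 / 2 * s) + -(1 / 2 * s) + -(1 / 2 * s) + -(1 / 2 * s) + -(1 / 2 * s) by ring] at h
  simp only [exp_add] at h
  have hE := exp_ne_zero (-(1 / 2 * s))
  have hl : 2 * torsionZeta 2 s - torsionZeta 1 s - torsionZeta 3 s =
      thetaLogOne (2 * s) (7 * s) + thetaLogOne (2 * s) (7 * s) +
        (-thetaLogOne (3 * s) (7 * s) - 1) - (thetaLogOne s (7 * s) - 1) := by
    simp only [torsionZeta, one_mul]; ring
  rw [hl, h]
  generalize thetaSeries 0 (3 * s) (7 * s) = θ₃ at *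
  generalize thetaSeries 0 (2 * s) (7 * s) = θ₂ at *
  generalize exp (-(1 / 2 * s)) = E at *
  field_simp

theorem torsion_addition_three (hs : s.re < 0) :
    2 * torsionZeta 3 s - torsionZeta 1 s + torsionZeta 2 s =
      -thetaSeries 1 0 (7 * s) * exp (-s) *
        (thetaSeries 0 (2 * s) (7 * s) / thetaSeries 0 (3 * s) (7 * s) ^ 2) := by
  have n1 := theta_one_ne_zero hs
  have n2 := theta_two_ne_zero hs
  have n3 := theta_three_ne_zero hs
  have tn : thetaSeries 0 (-s) (7 * s) = -thetaSeries 0 s (7 * s) := by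
    simpa using thetaSeries_neg 0 s (7 * s)
  have h := thetaLog_addition (A := 3 * s) (B := 3 * s) (C := -s) (seven_mul_re_neg hs) n3 n3
    (by rw [tn]; exact neg_ne_zero.2 n1)
    (by rw [show 3 * s + 3 * s + -s = 5 * s by ring]; exact theta_five_ne_zero hs)
  rw [show 3 * s + 3 * s + -s = (7 - 2) * s by ring, show 3 * s + 3 * s = (7 - 1) * s by ring,
    show 3 * s + -s = 2 * s by ring, tn, thetaLogOne_neg,
    thetaLogOne_reflect hs n2, theta_reflect 2, theta_reflect 1, one_mul,
    show (1 - 7 / 2) * s = (2 - 7 / 2) * s + -s by ring, exp_add] at h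
  have hE := exp_ne_zero (-s)
  have hE' := exp_ne_zero ((2 - 7 / 2) * s)
  have hl : 2 * torsionZeta 3 s - torsionZeta 1 s + torsionZeta 2 s =
      thetaLogOne (3 * s) (7 * s) + thetaLogOne (3 * s) (7 * s) +
        -thetaLogOne s (7 * s) - (-thetaLogOne (2 * s) (7 * s) - 1) := by
    simp only [torsionZeta, one_mul]; ring
  rw [hl, h]
  generalize thetaSeries 0 (3 * s) (7 * s) = θ₃ at *
  generalize thetaSeries 0 (2 * s) (7 * s) = θ₂ at *
  generalize exp (-s) = E at *
  generalize exp ((2 - 7 / 2) * s) = E' at *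
  field_simp

end

/-! ### Elimination. -/

/-- The algebraic content of the septic differential equations: `e`, `l`, `m`, `n` are the first
four logarithmic derivatives of the theta function at the torsion points and `p` is the value of
the Eisenstein series. -/
theorem septic_algebra {e₁ e₂ e₃ l₁ l₂ l₃ m₁ m₂ m₃ n₁ n₂ n₃ p x y z : ℂ}
    (hx : x = 2 * e₃ - e₁ + e₂) (hy : y = 2 * e₂ - e₁ - e₃) (hz : z = -(2 * e₁ + e₂ + e₃))
    (h₁ : 2 * l₁ + l₂ = p / 4 - (2 * e₁ - e₂) ^ 2)
    (h₂ : 2 * l₂ + l₃ = p / 4 - (2 * e₂ + e₃) ^ 2)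
    (h₃ : 2 * l₃ + l₁ = p / 4 - (2 * e₃ + e₁) ^ 2)
    (h₄ : l₁ + l₂ + l₃ = p / 4 - (e₁ + e₂ - e₃) ^ 2)
    (h₁₂ : 2 * (e₁ + e₁ - e₂) * (l₁ - l₂) = -m₁ - m₂)
    (h₁₃ : 2 * (e₁ + e₂ - e₃) * (l₁ - l₃) = -m₁ - m₃)
    (h₂₃ : 2 * (e₂ + e₁ - e₃) * (l₂ - l₃) = -m₂ - m₃)
    (k₁₂ : 2 * (l₁ - l₂) ^ 2 + 2 * (e₁ + e₁ - e₂) * (m₁ - m₂) = -n₁ - n₂)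
    (k₁₃ : 2 * (l₁ - l₃) ^ 2 + 2 * (e₁ + e₂ - e₃) * (m₁ - m₃) = -n₁ - n₃)
    (k₂₃ : 2 * (l₂ - l₃) ^ 2 + 2 * (e₂ + e₁ - e₃) * (m₂ - m₃) = -n₂ - n₃) :
    2 * (7 / 2 * m₃ + 7 * e₃ * l₃) - (7 / 2 * m₁ + 7 * e₁ * l₁) + (7 / 2 * m₂ + 7 * e₂ * l₂) =
      x / 12 * (5 * y ^ 2 + 5 * z ^ 2 - 7 * x ^ 2 - 20 * y * z - 52 * x * y + 7 * p) ∧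
    2 * (7 / 2 * m₂ + 7 * e₂ * l₂) - (7 / 2 * m₁ + 7 * e₁ * l₁) - (7 / 2 * m₃ + 7 * e₃ * l₃) =
      y / 12 * (5 * z ^ 2 + 5 * x ^ 2 - 7 * y ^ 2 + 20 * x * z - 52 * y * z + 7 * p) ∧
    -(2 * (7 / 2 * m₁ + 7 * e₁ * l₁) + (7 / 2 * m₂ + 7 * e₂ * l₂) + (7 / 2 * m₃ + 7 * e₃ * l₃)) =
      z / 12 * (5 * x ^ 2 + 5 * y ^ 2 - 7 * z ^ 2 - 20 * x * y + 52 * x * z + 7 * p) ∧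
    4 * (2 * (7 / 2 * n₁ + 7 * l₁ ^ 2 + 7 * e₁ * m₁) + (7 / 2 * n₂ + 7 * l₂ ^ 2 + 7 * e₂ * m₂) +
        2 * (2 * e₁ - e₂) * (2 * (7 / 2 * m₁ + 7 * e₁ * l₁) - (7 / 2 * m₂ + 7 * e₂ * l₂))) =
      7 / 12 * (p ^ 2 - x ^ 4 + 4 * x ^ 3 * y + 12 * x * y ^ 3 - y ^ 4 - 12 * x ^ 3 * z
        + 4 * y ^ 3 * z - 4 * x * z ^ 3 + 12 * y * z ^ 3 - z ^ 4) := by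
  -- The l and p cancel in h₁ + h₂ + h₃ - 3 h₄, leaving the one quadratic relation among the e.
  have c : e₁ ^ 2 + e₂ ^ 2 + e₃ ^ 2 - 5 * e₁ * e₂ + 5 * e₂ * e₃ + 5 * e₁ * e₃ = 0 := by
    linear_combination (h₁ + h₂ + h₃ - 3 * h₄) / 2
  obtain rfl : n₃ = -n₁ - (2 * (l₁ - l₃) ^ 2 + 2 * (e₁ + e₂ - e₃) * (m₁ - m₃)) := by
    linear_combination k₁₃
  obtain rfl : n₂ = -n₁ - (2 * (l₁ - l₂) ^ 2 + 2 * (e₁ + e₁ - e₂) * (m₁ - m₂)) := by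
    linear_combination k₁₂
  -- All three pairwise sums of the n are known, hence each n; the m are found in the same way
  -- below.
  obtain rfl : n₁ = (2 * (l₂ - l₃) ^ 2 + 2 * (e₂ + e₁ - e₃) * (m₂ - m₃)
      - (2 * (l₁ - l₂) ^ 2 + 2 * (e₁ + e₁ - e₂) * (m₁ - m₂))
      - (2 * (l₁ - l₃) ^ 2 + 2 * (e₁ + e₂ - e₃) * (m₁ - m₃))) / 2 := by
    linear_combination -k₂₃ / 2
  obtain rfl : m₃ = -m₁ - 2 * (e₁ + e₂ - e₃) * (l₁ - l₃) := by linear_combination h₁₃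
  obtain rfl : m₂ = -m₁ - 2 * (e₁ + e₁ - e₂) * (l₁ - l₂) := by linear_combination h₁₂
  obtain rfl : m₁ = (2 * (e₂ + e₁ - e₃) * (l₂ - l₃) - 2 * (e₁ + e₁ - e₂) * (l₁ - l₂)
      - 2 * (e₁ + e₂ - e₃) * (l₁ - l₃)) / 2 := by linear_combination -h₂₃ / 2
  obtain rfl : l₃ = p / 4 - (2 * e₂ + e₃) ^ 2 - 2 * l₂ := by linear_combination h₂
  obtain rfl : l₂ = p / 4 - (2 * e₁ - e₂) ^ 2 - 2 * l₁ := by linear_combination h₁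
  -- The 9 = 2³ + 1 is the determinant of the cyclic system 2l₁ + l₂, 2l₂ + l₃, 2l₃ + l₁.
  obtain rfl : l₁ = (3 * (p / 4) + 2 * (2 * e₂ + e₃) ^ 2 - 4 * (2 * e₁ - e₂) ^ 2
      - (2 * e₃ + e₁) ^ 2) / 9 := by linear_combination h₃ / 9
  subst hx hy hz
  refine ⟨?_, ?_, ?_, ?_⟩
  -- Only e₁, e₂, e₃, p remain. Each equation differs from an identity by a multiple of c, and the
  -- coefficient is the polynomial cofactor.
  · linear_combination (-125 / 18 * e₁ - 43 / 18 * e₂ - 43 / 9 * e₃) * c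
  · linear_combination (85 / 18 * e₁ - 1 / 9 * e₂ + 1 / 18 * e₃) * c
  · linear_combination (-20 / 9 * e₁ - 83 / 18 * e₂ - 41 / 18 * e₃) * c
  · linear_combination (-833 / 54 * e₁ ^ 2 + 2317 / 54 * e₁ * e₂ + 1379 / 54 * e₁ * e₃
      - 4697 / 54 * e₂ ^ 2 - 3493 / 54 * e₂ * e₃ - 1001 / 54 * e₃ ^ 2) * c

/-! ### Return to the variable q. -/

/-- After n ↦ -n the base is -(14(n - 1/2) + 2r). Its square over 56 is 7(n - 1/2)²/2 + r(n - 1/2) +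
r²/14. -/
theorem tsum_shifted_gaussian (s r m : ℂ) (h : m = 7 - 2 * r) :
    ∑' n : ℤ, (-1 : ℂ) ^ n * exp (s * ((14 * (n : ℂ) + m) ^ 2 / 56)) =
      exp (r ^ 2 / 14 * s) * thetaSeries 0 (r * s) (7 * s) := by
  unfold thetaSeries
  rw [← (Equiv.neg ℤ).tsum_eq, ← tsum_mul_left]
  refine tsum_congr fun n ↦ ?_
  have e : (-1 : ℂ) ^ (-n) = (-1) ^ n := by rw [zpow_neg, ← inv_zpow]; norm_num
  rw [Equiv.neg_apply, e, thetaTerm, pow_zero, mul_one, mul_left_comm, ← exp_add, h]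
  congr 2
  push_cast
  ring

section

variable {q s : ℂ}

theorem septicA_eq (hq : q ≠ 0) :
    septicA q = -(exp (1 / 14 * log q) * thetaSeries 0 (log q) (7 * log q)) := by
  have := tsum_shifted_gaussian (log q) 1 5 (by norm_num)
  simp only [septicA, cpow_def_of_ne_zero hq]
  rw [this]
  norm_num

theorem septicB_eq (hq : q ≠ 0) :
    septicB q = exp (4 / 14 * log q) * thetaSeries 0 (2 * log q) (7 * log q) := by
  have := tsum_shifted_gaussian (log q) 2 3 (by norm_num)
  simp only [septicB, cpow_def_of_ne_zero hq]
  rw [this]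
  norm_num

theorem septicC_eq (hq : q ≠ 0) :
    septicC q = exp (9 / 14 * log q) * thetaSeries 0 (3 * log q) (7 * log q) := by
  have := tsum_shifted_gaussian (log q) 3 1 (by norm_num)
  simp only [septicC, cpow_def_of_ne_zero hq]
  rw [this]
  norm_num

theorem log_re_neg (hq : q ≠ 0) (hq1 : ‖q‖ < 1) : (log q).re < 0 := by
  rw [log_re]
  exact Real.log_neg (norm_pos_iff.2 hq) hq1

theorem cpow_mul_qPochInf (hq : q ≠ 0) (hq1 : ‖q‖ < 1) :
    q ^ (7 / 8 : ℂ) * qPochInf (q ^ 7) (q ^ 7) ^ 3 = -thetaSeries 1 0 (7 * log q) := by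
  have e : exp (7 * log q) = q ^ 7 := by
    have := exp_nat_mul (log q) 7
    rw [exp_log hq] at this
    exact_mod_cast this
  rw [thetaSeries_one_zero (seven_mul_re_neg (log_re_neg hq hq1)), e, cpow_def_of_ne_zero hq,
    show log q * (7 / 8) = 7 * log q / 8 by ring]
  ring

theorem septicX_eq (hq : q ≠ 0) (hq1 : ‖q‖ < 1) :
    septicX q = -thetaSeries 1 0 (7 * log q) * exp (-log q) *
      (thetaSeries 0 (2 * log q) (7 * log q) / thetaSeries 0 (3 * log q) (7 * log q) ^ 2) := by
  have e : exp (4 / 14 * log q) = exp (-log q) * exp (9 / 14 * log q) ^ 2 := by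
    rw [← exp_nat_mul, ← exp_add]; congr 1; push_cast; ring
  have h := exp_ne_zero (9 / 14 * log q)
  rw [septicX, cpow_mul_qPochInf hq hq1, septicB_eq hq, septicC_eq hq, e]
  generalize exp (9 / 14 * log q) = E at *
  rw [mul_assoc (exp (-log q)), mul_pow, mul_div_assoc, mul_div_mul_left _ _ (pow_ne_zero 2 h)]
  ring

theorem septicY_eq (hq : q ≠ 0) (hq1 : ‖q‖ < 1) :
    septicY q = -thetaSeries 1 0 (7 * log q) * exp (-(1 / 2 * log q)) *
      (thetaSeries 0 (log q) (7 * log q) / thetaSeries 0 (2 * log q) (7 * log q) ^ 2) := by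
  have e : exp (1 / 14 * log q) = exp (-(1 / 2 * log q)) * exp (4 / 14 * log q) ^ 2 := by
    rw [← exp_nat_mul, ← exp_add]; congr 1; push_cast; ring
  have h := exp_ne_zero (4 / 14 * log q)
  rw [septicY, cpow_mul_qPochInf hq hq1, septicA_eq hq, septicB_eq hq, e]
  generalize exp (4 / 14 * log q) = E at *
  rw [mul_assoc (exp (-(1 / 2 * log q))), mul_pow, neg_div, mul_div_assoc,
    mul_div_mul_left _ _ (pow_ne_zero 2 h)]
  ring

theorem septicZ_eq (hq : q ≠ 0) (hq1 : ‖q‖ < 1) :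
    septicZ q = -thetaSeries 1 0 (7 * log q) * exp (1 / 2 * log q) *
      (thetaSeries 0 (3 * log q) (7 * log q) / thetaSeries 0 (log q) (7 * log q) ^ 2) := by
  have e : exp (9 / 14 * log q) = exp (1 / 2 * log q) * exp (1 / 14 * log q) ^ 2 := by
    rw [← exp_nat_mul, ← exp_add]; congr 1; push_cast; ring
  have h := exp_ne_zero (1 / 14 * log q)
  rw [septicZ, cpow_mul_qPochInf hq hq1, septicC_eq hq, septicA_eq hq, e, neg_sq]
  generalize exp (1 / 14 * log q) = E at *
  rw [mul_assoc (exp (1 / 2 * log q)), mul_pow, mul_div_assoc,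
    mul_div_mul_left _ _ (pow_ne_zero 2 h)]
  ring

/-- Quotients of theta values at torsion points that depend on `exp s` only. -/
theorem torsion_quotient_eq (hs : s.re < 0) (r r' u u' : ℕ) (hr : r + r' = 7) (hu : u + u' = 7)
    (j : ℕ)
    (α : ℂ) (hα : α - r / 2 + u = j) :
    -thetaSeries 1 0 (7 * s) * exp (α * s) *
        (thetaSeries 0 (r * s) (7 * s) / thetaSeries 0 (u * s) (7 * s) ^ 2) =
      exp s ^ j * (qPochInf (exp s ^ 7) (exp s ^ 7) ^ 3 *
        ((qPochInf (exp s ^ r) (exp s ^ 7) * qPochInf (exp s ^ r') (exp s ^ 7) *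
          qPochInf (exp s ^ 7) (exp s ^ 7)) /
        (qPochInf (exp s ^ u) (exp s ^ 7) * qPochInf (exp s ^ u') (exp s ^ 7) *
          qPochInf (exp s ^ 7) (exp s ^ 7)) ^ 2)) := by
  have e : exp (7 * s) = exp s ^ 7 := by exact_mod_cast exp_nat_mul s 7
  -- The hypothesis on α says exactly that the exponents balance. As j is a natural number, the
  -- quotient is unchanged under s ↦ s + 2πi.
  have e1 : exp (7 * s / 8) * exp (α * s) * exp ((7 / 8 - r / 2) * s) =
      exp s ^ j * exp ((7 / 8 - u / 2) * s) ^ 2 := by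
    rw [← exp_nat_mul, ← exp_nat_mul, ← exp_add, ← exp_add, ← exp_add]
    congr 1
    push_cast
    linear_combination s * hα
  have h := pow_ne_zero 2 (exp_ne_zero ((7 / 8 - u / 2) * s))
  rw [thetaSeries_one_zero (seven_mul_re_neg hs), e, thetaSeries_torsion_eq hs r r' hr,
    thetaSeries_torsion_eq hs u u' hu]
  generalize qPochInf (exp s ^ r) _ * _ * _ = x
  generalize qPochInf (exp s ^ u) _ * _ * _ = y
  rw [mul_pow, mul_div_mul_comm]
  generalize x / y ^ 2 = F
  generalize exp ((7 / 8 - u / 2) * s) ^ 2 = E at *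
  generalize exp ((7 / 8 - r / 2) * s) = E' at *
  generalize exp (α * s) = E'' at *
  field_simp
  linear_combination F * qPochInf (exp s ^ 7) (exp s ^ 7) ^ 3 * e1

theorem log_exp_re_neg (hs : s.re < 0) : (log (exp s)).re < 0 :=
  log_re_neg (exp_ne_zero s) (norm_exp_lt_one hs)

theorem septicX_exp (hs : s.re < 0) :
    septicX (exp s) = 2 * torsionZeta 3 s - torsionZeta 1 s + torsionZeta 2 s := by
  -- Stated for every s because it is applied both at s and at log (exp s), which may differ by a
  -- multiple of 2πi. The right side sees only exp s.
  have h := fun {s : ℂ} (hs : s.re < 0) ↦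
    torsion_quotient_eq hs 2 5 3 4 rfl rfl 1 (-1) (by norm_num)
  simp only [neg_one_mul, Nat.cast_ofNat] at h
  rw [torsion_addition_three hs, h hs, septicX_eq (exp_ne_zero s) (norm_exp_lt_one hs),
    h (log_exp_re_neg hs), exp_log (exp_ne_zero s)]

theorem septicY_exp (hs : s.re < 0) :
    septicY (exp s) = 2 * torsionZeta 2 s - torsionZeta 1 s - torsionZeta 3 s := by
  have h := fun {s : ℂ} (hs : s.re < 0) ↦
    torsion_quotient_eq hs 1 6 2 5 rfl rfl 1 (-(1 / 2)) (by norm_num)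
  simp only [neg_mul, Nat.cast_ofNat, Nat.cast_one, one_mul] at h
  simp only [← neg_mul] at h
  rw [torsion_addition_two hs, ← neg_mul (1 / 2 : ℂ), h hs,
    septicY_eq (exp_ne_zero s) (norm_exp_lt_one hs), ← neg_mul (1 / 2 : ℂ),
    h (log_exp_re_neg hs), exp_log (exp_ne_zero s)]

theorem septicZ_exp (hs : s.re < 0) :
    septicZ (exp s) = -(2 * torsionZeta 1 s + torsionZeta 2 s + torsionZeta 3 s) := by
  have h := fun {s : ℂ} (hs : s.re < 0) ↦
    torsion_quotient_eq hs 3 4 1 6 rfl rfl 0 (1 / 2) (by norm_num)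
  simp only [Nat.cast_ofNat, Nat.cast_one, one_mul] at h
  rw [torsion_addition_one hs, h hs, septicZ_eq (exp_ne_zero s) (norm_exp_lt_one hs),
    h (log_exp_re_neg hs), exp_log (exp_ne_zero s)]

theorem septicP_exp (s : ℂ) : septicP (exp s) = eisE2 (exp (7 * s)) := by
  rw [septicP]
  congr 1
  exact_mod_cast (exp_nat_mul s 7).symm

/-- A derivative in `log q` gives a derivative in `q`. -/
theorem hasDerivAt_of_comp_exp {f F : ℂ → ℂ} {F' : ℂ} (h : ∀ s : ℂ, s.re < 0 → f (exp s) = F s)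
    (hs : s.re < 0) (hF : HasDerivAt F F' s) : HasDerivAt f (F' / exp s) (exp s) := by
  have h0 := exp_ne_zero s
  -- A local branch of the logarithm with value s at exp s. It avoids the cut of the principal
  -- branch, since q / exp s is near 1.
  have hg : HasDerivAt (fun q ↦ log (q / exp s) + s) (1 / exp s) (exp s) := by
    have h1 := (((hasDerivAt_id (exp s)).div_const (exp s)).clog
      (by simp)).add_const s
    refine h1.congr_deriv ?_
    simp
  have hgs : log (exp s / exp s) + s = s := by simp
  have hF' : HasDerivAt F F' (log (exp s / exp s) + s) := by rwa [hgs]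
  have hc := hF'.comp (exp s) hg
  rw [mul_one_div] at hc
  refine hc.congr_of_eventuallyEq ?_
  have hre : ∀ᶠ q in 𝓝 (exp s), (log (q / exp s) + s).re < 0 :=
    (continuous_re.continuousAt.comp hg.continuousAt).eventually_lt continuousAt_const
      (by simpa [hgs] using hs)
  filter_upwards [hre, eventually_ne_nhds h0] with q hq hq0
  have e : exp (log (q / exp s) + s) = q := by
    rw [exp_add, exp_log (div_ne_zero hq0 h0), div_mul_cancel₀ _ h0]
  rw [Function.comp_apply, ← h _ hq, e]

end

/-! ### The differential equations. -/

theorem theorem1p1 (q : ℂ) (hq0 : q ≠ 0) (hq1 : ‖q‖ < 1) :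
    -- the quotients `x`, `y`, `z` have nonzero denominators
    (septicA q ≠ 0 ∧ septicB q ≠ 0 ∧ septicC q ≠ 0) ∧
    (DifferentiableAt ℂ septicX q ∧ DifferentiableAt ℂ septicY q ∧
      DifferentiableAt ℂ septicZ q ∧ DifferentiableAt ℂ septicP q) ∧
    q * deriv septicX q = septicX q / 12 *
      (5 * septicY q ^ 2 + 5 * septicZ q ^ 2 - 7 * septicX q ^ 2
        - 20 * septicY q * septicZ q - 52 * septicX q * septicY q + 7 * septicP q) ∧
    q * deriv septicY q = septicY q / 12 *
      (5 * septicZ q ^ 2 + 5 * septicX q ^ 2 - 7 * septicY q ^ 2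
        + 20 * septicX q * septicZ q - 52 * septicY q * septicZ q + 7 * septicP q) ∧
    q * deriv septicZ q = septicZ q / 12 *
      (5 * septicX q ^ 2 + 5 * septicY q ^ 2 - 7 * septicZ q ^ 2
        - 20 * septicX q * septicY q + 52 * septicX q * septicZ q + 7 * septicP q) ∧
    q * deriv septicP q = 7 / 12 *
      (septicP q ^ 2 - septicX q ^ 4 + 4 * septicX q ^ 3 * septicY q
        + 12 * septicX q * septicY q ^ 3 - septicY q ^ 4
        - 12 * septicX q ^ 3 * septicZ q + 4 * septicY q ^ 3 * septicZ q
        - 4 * septicX q * septicZ q ^ 3 + 12 * septicY q * septicZ q ^ 3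
        - septicZ q ^ 4) := by
  obtain ⟨s, hs, hsq, hlog⟩ : ∃ s : ℂ, s.re < 0 ∧ exp s = q ∧ log q = s :=
    ⟨log q, log_re_neg hq0 hq1, exp_log hq0, rfl⟩
  have n₁ : thetaSeries 0 (1 * s) (7 * s) ≠ 0 := by simpa using theta_one_ne_zero hs
  have n₂ := theta_two_ne_zero hs
  have n₃ := theta_three_ne_zero hs
  refine ⟨⟨?_, ?_, ?_⟩, ?_⟩
  · rw [septicA_eq hq0, hlog]
    exact neg_ne_zero.2 (mul_ne_zero (exp_ne_zero _) (theta_one_ne_zero hs))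
  · rw [septicB_eq hq0, hlog]
    exact mul_ne_zero (exp_ne_zero _) n₂
  · rw [septicC_eq hq0, hlog]
    exact mul_ne_zero (exp_ne_zero _) n₃
  have d₁ := hasDerivAt_torsionZeta hs 1 n₁
  have d₂ := hasDerivAt_torsionZeta hs 2 n₂
  have d₃ := hasDerivAt_torsionZeta hs 3 n₃
  have dX := hasDerivAt_of_comp_exp (f := septicX) (fun s hs ↦ septicX_exp hs) hs
    (((d₃.const_mul 2).sub d₁).add d₂)
  have dY := hasDerivAt_of_comp_exp (f := septicY) (fun s hs ↦ septicY_exp hs) hs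
    (((d₂.const_mul 2).sub d₁).sub d₃)
  have dZ := hasDerivAt_of_comp_exp (f := septicZ) (fun s hs ↦ septicZ_exp hs) hs
    (((d₁.const_mul 2).add d₂).add d₃).neg
  -- 𝒫 is differentiated through `torsion_square_one` solved for E₂, so only the derivatives already
  -- known at the torsion points are needed.
  have dP := hasDerivAt_of_comp_exp (f := septicP)
    (F := fun s ↦ 4 * (2 * thetaLogTwo (1 * s) (7 * s) + thetaLogTwo (2 * s) (7 * s) +
      (2 * torsionZeta 1 s - torsionZeta 2 s) ^ 2))
    (fun s hs ↦ by
      rw [septicP_exp]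
      linear_combination -4 * torsion_square_one hs) hs
    (((((hasDerivAt_torsion_thetaLogTwo hs 1 n₁).const_mul 2).add
      (hasDerivAt_torsion_thetaLogTwo hs 2 n₂)).add
        (((d₁.const_mul 2).sub d₂).pow 2)).const_mul 4)
  obtain ⟨h₁₂, k₁₂⟩ := torsion_derivs hs (by norm_num : (1 : ℂ) + 1 = 2) n₁ n₁ n₂
  obtain ⟨h₁₃, k₁₃⟩ := torsion_derivs hs (by norm_num : (1 : ℂ) + 2 = 3) n₁ n₂ n₃
  obtain ⟨h₂₃, k₂₃⟩ := torsion_derivs hs (by norm_num : (2 : ℂ) + 1 = 3) n₂ n₁ n₃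
  obtain ⟨gX, gY, gZ, gP⟩ := septic_algebra (septicX_exp hs) (septicY_exp hs) (septicZ_exp hs)
    (torsion_square_one hs) (torsion_square_two hs) (torsion_square_three hs)
    (torsion_square_mixed hs) h₁₂ h₁₃ h₂₃ k₁₂ k₁₃ k₂₃
  rw [← septicP_exp s] at gX gY gZ gP
  rw [hsq] at dX dY dZ dP gX gY gZ gP
  refine ⟨⟨dX.differentiableAt, dY.differentiableAt, dZ.differentiableAt, dP.differentiableAt⟩,
    ?_, ?_, ?_, ?_⟩
  · rw [dX.deriv, mul_div_cancel₀ _ hq0, ← gX]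
  · rw [dY.deriv, mul_div_cancel₀ _ hq0, ← gY]
  · rw [dZ.deriv, mul_div_cancel₀ _ hq0, ← gZ]
  · rw [dP.deriv, mul_div_cancel₀ _ hq0, ← gP]
    simp only [Pi.sub_apply]
    push_cast
    ring
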